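/- Let $L$ be a first-order language containing a binary relation symbol $<$, and let $T$ be a complete $L$-theory that has infinite models and in all of whose models $<$ is a linear order. "Definable" means definable by an $L$-formula without parameters, unless parameters are mentioned. Assume that $T$ satisfies the strong linear binarity condition (SLB) for every model $M\models T$, every initial part $C\subseteq M$ (that is, $c\in C$ and $d<c$ imply $d\in C$) and every automorphism $f$ of $M$ with $f(C)=C$, the map $g$ given by $g(x)=f(x)$ for $x\in C$ and $g(x)=x$ for $x\notin C$ is an automorphism of $M$. Let $M$ be any model of $T$, let $A\subseteq M$, and let $D\subseteq M$ be definable with parameters from $A$. Then: 1. $D$ is a (finite) Boolean combination of definable subsets of $M$, intervals with endpoints in $M\cup\{\pm\infty\}$, and classes of definable convex equivalence relations on $M$ (equivalence relations on $M$ that are definable and all of whose classes are convex subsets of $(M,<)$). 2. For every complete type $q\in S_1(T)$, with set of realizations $q(M)$ in $M$, the set $D\cap q(M)$ has only finitely many convex components in the ordered set $(q(M),<)$. 3. $D$ can be partitioned into finitely many sets, each of which is definable with parameters from $A$ and is definably convex, i.e. is a convex subset of $(P,<)$ for some definable set $P\subseteq M$. In particular, $T$ is weakly quasi-o-minimal: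 every parametrically definable subset of a model of $T$ is a Boolean combination of definable sets and convex sets. -/

import Mathlib

universe u v w

namespace LinearTheory

open FirstOrder FirstOrder.Language FirstOrder.Language.Structure

/-- In the `L`-structure `M`, the binary relation symbol `lt` is interpreted by the strict order
of `M`. -/
def InterpretsLT {L : FirstOrder.Language.{u, v}} (lt : L.Relations 2)
    (M : Type w) [L.Structure M] [LinearOrder M] : Prop :=
  ∀ a b : M, RelMap lt ![a, b] ↔ a < b

/-- `T` is a theory of linearly ordered structures: in every model of `T` the symbol `lt` defines
a strict linear order. -/
def IsTheoryOfLinearOrders {L : FirstOrder.Language.{u, v}} (lt : L.Relations 2) (T : L.Theory) : Prop :=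
  ∀ M : Theory.ModelType.{u, v, max u v} T,
    IsStrictTotalOrder M fun a b => RelMap lt ![a, b]

/-- `T` has an infinite model. -/
def HasInfiniteModel {L : FirstOrder.Language.{u, v}} (T : L.Theory) : Prop :=
  ∃ M : Theory.ModelType.{u, v, max u v} T, Infinite M

/-- The strong linear binarity condition: for every model `M`, every initial part `C` of `M` and
every automorphism `f` of `M` fixing `C` setwise, the map that is `f` on `C` and the identity off
`C` is an automorphism of `M`. -/
def SLB {L : FirstOrder.Language.{u, v}} (lt : L.Relations 2) (T : L.Theory) : Prop :=
  ∀ (M : Type (max u v)) [L.Structure M] [LinearOrder M] [Nonempty M] [T.Model M],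
    InterpretsLT lt M →
    ∀ (C : Set M), IsLowerSet C → ∀ f : M ≃[L] M, f '' C = C →
      ∃ g : M ≃[L] M, (∀ x ∈ C, g x = f x) ∧ ∀ x ∉ C, g x = x

section Sets

variable (L : FirstOrder.Language.{u, v}) {M : Type w} [L.Structure M]

/-- `P` is definable in `M` without parameters. -/
def IsUnaryDefinable (P : Set M) : Prop :=
  (∅ : Set M).Definable₁ L P

variable [LinearOrder M]

/-- `I` is an open ray with endpoint in `M`. All other intervals with endpoints in `M` or `±∞` are
Boolean combinations of such rays. -/
def IsRay (I : Set M) : Prop :=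
  ∃ a : M, I = Set.Ioi a ∨ I = Set.Iio a

/-- `E` is definable without parameters and its classes are convex. -/
def IsDefinableConvexEquiv (E : Setoid M) : Prop :=
  (∅ : Set M).Definable₂ L {p : M × M | E p.1 p.2} ∧ ∀ a : M, {x | E x a}.OrdConnected

/-- `K` is a class of some parameter-free definable convex equivalence relation. -/
def IsDefinableConvexClass (K : Set M) : Prop :=
  ∃ E : Setoid M, IsDefinableConvexEquiv L E ∧ ∃ a : M, K = {x | E x a}

/-- `D` is a convex subset of the ordered set `P`, for some parameter-free definable `P`. -/
def IsDefinablyConvex (D : Set M) : Prop :=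
  ∃ P : Set M, IsUnaryDefinable L P ∧ D ⊆ P ∧
    ∀ x ∈ D, ∀ y ∈ D, ∀ z ∈ P, x ≤ z → z ≤ y → z ∈ D

end Sets

/-- The convex components, in the ordered set `X`, of `D ∩ X`. -/
def convexComponentsOn {M : Type w} [LinearOrder M] (X D : Set M) : Set (Set X) :=
  {K | ∃ x : X, (x : M) ∈ D ∧ K = Set.ordConnectedComponent (Subtype.val ⁻¹' D) x}

/-- The set of realizations in `M` of a complete 1-type of `T`. -/
def locus {L : FirstOrder.Language.{u, v}} {T : L.Theory} (M : Type w) [L.Structure M] [Nonempty M]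
    [T.Model M] (q : T.CompleteType (Fin 1)) : Set M :=
  {x | T.typeOf (fun _ : Fin 1 => x) = q}

/-- Weak quasi-o-minimality: in every model of `T`, every parametrically definable set of elements
is a Boolean combination of parameter-free definable sets and convex sets. -/
def IsWeaklyQuasiOMinimal {L : FirstOrder.Language.{u, v}} (lt : L.Relations 2) (T : L.Theory) : Prop :=
  ∀ (M : Type w) [L.Structure M] [LinearOrder M] [Nonempty M] [T.Model M],
    InterpretsLT lt M →
    ∀ D : Set M, (Set.univ : Set M).Definable₁ L D →
      D ∈ BooleanSubalgebra.closure {S : Set M | IsUnaryDefinable L S ∨ S.OrdConnected}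

end LinearTheory

-- In a model with enough automorphisms types are orbits, and SLB says that the automorphism group,
-- acting on the order, is closed under gluing with the identity along an invariant cut. Two facts
-- about such groups carry the theorem. Convexity (`IsGlueClosed.exists_fixing`): the orbits of the
-- pointwise stabilizer of a set are convex inside the orbits of the whole group. One parameter
-- (`IsGlueClosed.preserves_of_finset`): an initial part invariant under the stabilizer of a
-- nonempty finite set is invariant under the stabilizer of one of its points.
--
-- No saturated model is needed. Partial elementary maps extend to automorphisms of an elementary
-- extension, and compactness (`exists_finset_formulas_of_automorphisms`) turns each statement about
-- orbits into one about finitely many formulas, which holds in every model.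
--
-- Convexity gives finite sets `Θ` and `Δ` of formulas such that inside each `Δ`-class the set `D`
-- has at most `2 ^ |Θ|` convex components. Numbering these components from the left defines them
-- over the same parameters and gives the partition; since a complete type lies in one `Δ`-class, it
-- also bounds the components on the realizations of a type.
--
-- For the Boolean combination, a definably convex set is the trace on a definable set of a
-- difference of two definable initial parts, so an initial part `I` suffices, and it is definable
-- over one point `d`. Suppose `d ∈ I`; the other case is dual. Elements below `x` and elements
-- above `x` are independent over `x`, so among the sets `I_w` of the family through `I` only
-- finitely many satisfy `w ≤ x ∈ I_w`. Ranking these by inclusion defines convex equivalence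
-- relations, and `I` is an open ray together with one class of such a relation.

universe b

namespace LinearTheory

open FirstOrder FirstOrder.Language FirstOrder.Language.Structure

/-! ### Compactness for families of formulas -/

/-- If every finite part of a family of formulas is realized in `M`, then the whole family is
realized in a structure elementarily equivalent to `M`. -/
theorem exists_realize_of_forall_finset {L : FirstOrder.Language.{u, v}} {M : Type w}
    [L.Structure M] [Nonempty M] {β : Type b} {κ : Type*} (φ : κ → L.Formula β)
    (h : ∀ s : Finset κ, ∃ x : β → M, ∀ k ∈ s, (φ k).Realize x) :
    ∃ (N : Type (max u v b)) (_ : L.Structure N) (_ : Nonempty N),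
      (M ≅[L] N) ∧ ∃ x : β → N, ∀ k, (φ k).Realize x := by
  -- The variables in `β` become new constants; the part `none`, the complete theory of `M`, forces
  -- elementary equivalence.
  let S : Option κ → L[[β]].Theory := fun o => o.elim
    ((L.lhomWithConstants β).onTheory (L.completeTheory M)) fun k => {Formula.equivSentence (φ k)}
  have hS : Theory.IsSatisfiable (⋃ o, S o) := by
    rw [Theory.isSatisfiable_iUnion_iff_isSatisfiable_iUnion_finset]
    intro s
    obtain ⟨x, hx⟩ := h (s.eraseNone)
    let := constantsOn.structure x
    have : M ⊨ ⋃ o ∈ s, S o := by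
      rw [Theory.model_iff]
      intro ψ hψ
      simp only [Set.mem_iUnion] at hψ
      obtain ⟨o, ho, hψ⟩ := hψ
      cases o with
      | none =>
        have : M ⊨ (L.lhomWithConstants β).onTheory (L.completeTheory M) :=
          (LHom.onTheory_model _ _).2 inferInstance
        exact this.realize_of_mem _ hψ
      | some k =>
        obtain rfl : ψ = Formula.equivSentence (φ k) := hψ
        rw [Formula.realize_equivSentence]
        exact hx k (by simpa using ho)
    exact Theory.Model.isSatisfiable M
  obtain ⟨N⟩ := hS
  let : L.Structure N := (L.lhomWithConstants β).reduct N
  have hN : ∀ o, ∀ ψ ∈ S o, (N : Type _) ⊨ ψ := fun o ψ hψ =>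
    Theory.realize_sentence_of_mem (⋃ o, S o) (Set.mem_iUnion.2 ⟨o, hψ⟩)
  refine ⟨N, inferInstance, inferInstance, ?_, fun a => (L.con a : N), fun k => ?_⟩
  · have : (N : Type _) ⊨ L.completeTheory M :=
      (LHom.onTheory_model (L.lhomWithConstants β) _).1
        ((Theory.model_iff _).2 fun ψ hψ => hN none ψ hψ)
    rw [elementarilyEquivalent_iff]
    exact fun ψ => (realize_iff_of_model_completeTheory M N ψ).symm
  · rw [← Formula.realize_equivSentence]
    exact hN (some k) _ rfl

/-! ### Partial elementary maps -/

/-- A binary relation on `M` is elementary if matching tuples have the same type. -/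
def IsElementaryRel (L : FirstOrder.Language.{u, v}) {M : Type w} [L.Structure M]
    (R : Set (M × M)) : Prop :=
  ∀ (n : ℕ) (p : Fin n → M × M), (∀ k, p k ∈ R) → ∀ ψ : L.Formula (Fin n),
    ψ.Realize (fun k => (p k).1) ↔ ψ.Realize (fun k => (p k).2)

section

variable {L : FirstOrder.Language.{u, v}} {M : Type w} [L.Structure M] {R : Set (M × M)}

/-- A formula has finitely many free variables, so tuples indexed by `Fin n` control arbitrary
families. -/
theorem IsElementaryRel.realize_iff (hR : IsElementaryRel L R) {J : Type*} (p : J → M × M)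
    (hp : ∀ j, p j ∈ R) (ψ : L.Formula J) :
    ψ.Realize (fun j => (p j).1) ↔ ψ.Realize (fun j => (p j).2) := by
  classical
  let e := Fintype.equivFin ψ.freeVarFinset
  have key : ∀ x : J → M, ψ.Realize x ↔
      (Formula.relabel e (ψ.restrictFreeVar id : L.Formula ψ.freeVarFinset)).Realize
        (fun k => x (e.symm k)) := by
    intro x
    rw [Formula.realize_relabel]
    refine (BoundedFormula.realize_restrictFreeVar x ?_).symm
    simp
  rw [key, key]
  exact hR _ (fun k => p (e.symm k)) (fun k => hp _) _

theorem IsElementaryRel.functional (hR : IsElementaryRel L R) {a a' b b' : M}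
    (h : (a, b) ∈ R) (h' : (a', b') ∈ R) : a = a' ↔ b = b' := by
  have := hR 2 ![(a, b), (a', b')] (by simp [Fin.forall_fin_two, h, h'])
    ((Term.var 0).equal (Term.var 1))
  simpa using this

theorem IsElementaryRel.swap (hR : IsElementaryRel L R) :
    IsElementaryRel L (Prod.swap ⁻¹' R) := fun n p hp ψ =>
  (hR n (fun k => (p k).swap) hp ψ).symm

theorem isElementaryRel_of_forall {J : Type*} {s t : J → M}
    (h : ∀ ψ : L.Formula J, ψ.Realize s ↔ ψ.Realize t) :
    IsElementaryRel L (Set.range fun j => (s j, t j)) := by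
  intro n p hp ψ
  choose f hf using hp
  have := h (ψ.relabel f)
  rw [Formula.realize_relabel, Formula.realize_relabel] at this
  simpa only [← hf, Function.comp_def] using this

/-- A formula true of the identity assignment stays true of an assignment extending a given
elementary relation. -/
theorem IsElementaryRel.exists_realize (hR : IsElementaryRel L R) [Nonempty M] (Φ : L.Formula M)
    (hΦ : Φ.Realize id) : ∃ x : M → M, Φ.Realize x ∧ ∀ r ∈ R, x r.1 = r.2 := by
  classical
  let F := Φ.freeVarFinset
  -- Free variables in the domain of `R` become parameters. The others are quantified existentially,
  -- and the resulting statement is transported along `R`.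
  let g : F → R ⊕ F := fun m => if h : ∃ r ∈ R, r.1 = (m : M) then
    Sum.inl ⟨h.choose, h.choose_spec.1⟩ else Sum.inr m
  let Φ' : L.Formula (R ⊕ F) := Formula.relabel g (Φ.restrictFreeVar id : L.Formula F)
  have key : ∀ (x : M → M) (y : R ⊕ F → M), (∀ m : F, y (g m) = x m) →
      (Φ'.Realize y ↔ Φ.Realize x) := by
    intro x y hxy
    rw [Formula.realize_relabel]
    refine BoundedFormula.realize_restrictFreeVar x ?_
    intro m
    exact hxy m
  have h1 : (Φ'.iExs F).Realize (fun r : R => r.1.1) := by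
    rw [Formula.realize_iExs]
    refine ⟨fun m => m, (key id _ fun m => ?_).2 hΦ⟩
    simp only [g]
    split_ifs with h
    · exact h.choose_spec.2
    · rfl
  rw [hR.realize_iff (fun r : R => r.1) (fun r => r.2), Formula.realize_iExs] at h1
  obtain ⟨y, hy⟩ := h1
  let x : M → M := fun m => if h : ∃ r ∈ R, r.1 = m then h.choose.2 else
    if hm : m ∈ F then y ⟨m, hm⟩ else m
  refine ⟨x, (key x _ fun m => ?_).1 hy, fun r hr => ?_⟩
  · simp only [g, x]
    split_ifs with h h'
    · rfl
    · rfl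
    · exact absurd m.2 h'
  · have h : ∃ r' ∈ R, r'.1 = r.1 := ⟨r, hr, rfl⟩
    simp only [x, dif_pos h]
    exact (hR.functional h.choose_spec.1 hr).1 h.choose_spec.2

end

/-- Elementary relations on `M` extend to elementary self-maps of `M` into a common elementary
extension. -/
theorem exists_elementaryEmbedding_extending {L : FirstOrder.Language.{u, v}} {M : Type (max u v)}
    [L.Structure M] [Nonempty M] {ι : Type} (R : ι → Set (M × M))
    (hR : ∀ i, IsElementaryRel L (R i)) :
    ∃ (N : Type (max u v)) (_ : L.Structure N) (_ : Nonempty N) (e : M ↪ₑ[L] N)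
      (f : ι → M ↪ₑ[L] N), ∀ i, ∀ r ∈ R i, f i r.1 = e r.2 := by
  classical
  let Tr := {ψ : L.Formula M // ψ.Realize id}
  -- The variable `Sum.inl m` stands for `e m` and `Sum.inr (i, m)` for `f i m`. The formulas are an
  -- elementary diagram for each copy of `M` and the equations prescribed by `R i`.
  let φ : Tr ⊕ (ι × Tr) ⊕ (Σ i, R i) → L.Formula (M ⊕ ι × M) :=
    Sum.elim (fun ψ => ψ.1.relabel Sum.inl)
      (Sum.elim (fun ψ => ψ.2.1.relabel fun m => Sum.inr (ψ.1, m))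
        fun r => (Term.var (Sum.inr (r.1, r.2.1.1))).equal (Term.var (Sum.inl r.2.1.2)))
  obtain ⟨N, iN, nN, -, x, hx⟩ := exists_realize_of_forall_finset (M := M) φ (by
    intro s
    let S := {k // k ∈ s}
    -- With `e` interpreted as the identity the copies do not interact, so a finite part can be
    -- realized in `M` one index at a time.
    have h : ∀ i, ∃ x : M → M, (Formula.iInf (fun k : S => Sum.elim (fun _ => (⊤ : L.Formula M))
        (Sum.elim (fun ψ => if ψ.1 = i then ψ.2.1 else ⊤) fun _ => ⊤) k.1)).Realize x ∧
        ∀ r ∈ R i, x r.1 = r.2 := by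
      intro i
      refine (hR i).exists_realize _ ?_
      rw [Formula.realize_iInf]
      rintro ⟨k | ⟨j, k⟩ | k, hk⟩
      · simp
      · by_cases hj : j = i
        · simpa [hj] using k.2
        · simp [hj]
      · simp
    choose x hx hxR using h
    refine ⟨Sum.elim id fun p => x p.1 p.2, ?_⟩
    rintro (k | ⟨j, k⟩ | k) hk
    · simp only [φ, Sum.elim_inl, Formula.realize_relabel]
      exact k.2
    · simp only [φ, Sum.elim_inl, Sum.elim_inr, Formula.realize_relabel]
      have := hx j
      rw [Formula.realize_iInf] at this
      simpa [Function.comp_def] using this ⟨_, hk⟩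
    · simp [φ, hxR k.1 _ k.2.2])
  have hel : ∀ y : M → N, (∀ ψ : Tr, ψ.1.Realize y) → ∀ (n : ℕ) (ψ : L.Formula (Fin n))
      (z : Fin n → M), ψ.Realize (y ∘ z) ↔ ψ.Realize z := by
    intro y hy n ψ z
    constructor
    · intro h
      by_contra hn
      have := hy ⟨(ψ.relabel z).not, by
        rw [Formula.realize_not, Formula.realize_relabel]; exact hn⟩
      rw [Formula.realize_not, Formula.realize_relabel] at this
      exact this h
    · intro h
      have := hy ⟨ψ.relabel z, by rw [Formula.realize_relabel]; exact h⟩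
      rwa [Formula.realize_relabel] at this
  refine ⟨N, iN, nN, ⟨x ∘ Sum.inl, hel _ fun ψ => ?_⟩,
    fun i => ⟨fun m => x (Sum.inr (i, m)), hel _ fun ψ => ?_⟩, fun i r hr => ?_⟩
  · have := hx (Sum.inl ψ)
    simpa only [φ, Sum.elim_inl, Formula.realize_relabel] using this
  · have := hx (Sum.inr (Sum.inl (i, ψ)))
    simpa only [φ, Sum.elim_inl, Sum.elim_inr, Formula.realize_relabel, Function.comp_def] using this
  · have : x (Sum.inr (i, r.1)) = x (Sum.inl r.2) := by
      simpa [φ] using hx (Sum.inr (Sum.inr ⟨i, ⟨r, hr⟩⟩))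
    exact this

/-! ### Limits of elementary chains -/

section DirectLimit

variable {L : FirstOrder.Language.{u, v}} {ι : Type b} [Preorder ι] [IsDirectedOrder ι] [Nonempty ι]
  {G : ι → Type w} [∀ i, L.Structure (G i)] (f : ∀ i j, i ≤ j → G i ↪[L] G j)
  [DirectedSystem G fun i j h => f i j h]

/-- Tarski's chain argument. Elementarity of the transition maps enters only at the quantifier: an
element of the limit appears at a later stage, where the universal statement is still true. -/
theorem realize_directLimit_of
    (hf : ∀ i j (h : i ≤ j), ∃ e : G i ↪ₑ[L] G j, ∀ x, e x = f i j h x) {α : Type*} {n : ℕ}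
    (φ : L.BoundedFormula α n) : ∀ (i : ι) (x : α → G i) (y : Fin n → G i),
      φ.Realize (DirectLimit.of L ι G f i ∘ x) (DirectLimit.of L ι G f i ∘ y) ↔ φ.Realize x y := by
  induction φ with
  | falsum => exact fun i x y => Iff.rfl
  | equal t₁ t₂ =>
    intro i x y
    simp only [BoundedFormula.Realize, ← Sum.comp_elim, HomClass.realize_term]
    exact (DirectLimit.of L ι G f i).injective.eq_iff
  | rel R ts =>
    intro i x y
    simp only [BoundedFormula.Realize, ← Sum.comp_elim, HomClass.realize_term]
    exact (DirectLimit.of L ι G f i).map_rel R _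
  | imp φ ψ hφ hψ =>
    intro i x y
    rw [BoundedFormula.realize_imp, BoundedFormula.realize_imp, hφ, hψ]
  | all φ ih =>
    intro i x y
    rw [BoundedFormula.realize_all, BoundedFormula.realize_all]
    constructor
    · intro h a
      rw [← ih, Fin.comp_snoc]
      exact h _
    · intro h a
      obtain ⟨j, c, rfl⟩ := DirectLimit.exists_of a
      obtain ⟨k, hik, hjk⟩ := directed_of (· ≤ ·) i j
      obtain ⟨e, he⟩ := hf i k hik
      have h' : φ.all.Realize (e ∘ x) (e ∘ y) := by
        rw [e.map_boundedFormula]; exact h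
      have := (ih k _ _).2 (h' (f j k hjk c))
      rw [Fin.comp_snoc, DirectLimit.of_f] at this
      have hof : DirectLimit.of L ι G f k ∘ e = DirectLimit.of L ι G f i := by
        funext z
        simp only [Function.comp_apply, he, DirectLimit.of_f]
      rwa [← Function.comp_assoc, ← Function.comp_assoc, hof] at this

/-- The canonical map into the limit of a directed system of elementary embeddings is
elementary. -/
noncomputable def directLimitOf
    (hf : ∀ i j (h : i ≤ j), ∃ e : G i ↪ₑ[L] G j, ∀ x, e x = f i j h x) (i : ι) :
    G i ↪ₑ[L] Language.DirectLimit G f where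
  toFun := DirectLimit.of L ι G f i
  map_formula' n φ x := by
    have := realize_directLimit_of f hf φ i x default
    rwa [Unique.eq_default (_ ∘ default)] at this

end DirectLimit

/-! ### Extending elementary relations to automorphisms -/

/-- A total and surjective elementary relation is the graph of an automorphism. -/
theorem IsElementaryRel.exists_equiv {L : FirstOrder.Language.{u, v}} {M : Type w} [L.Structure M]
    {R : Set (M × M)} (hR : IsElementaryRel L R) (hdom : ∀ x, ∃ y, (x, y) ∈ R)
    (hran : ∀ y, ∃ x, (x, y) ∈ R) : ∃ σ : M ≃[L] M, ∀ r ∈ R, σ r.1 = r.2 := by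
  choose f hf using hdom
  choose g hg using hran
  have hfR : ∀ n (ψ : L.Formula (Fin n)) (x : Fin n → M),
      ψ.Realize (fun k => f (x k)) ↔ ψ.Realize x := fun n ψ x =>
    (hR n (fun k => (x k, f (x k))) (fun k => hf _) ψ).symm
  refine ⟨⟨⟨f, g, fun x => ?_, fun y => ?_⟩, fun {n} F x => ?_, fun {n} r x => ?_⟩,
    fun r hr => ?_⟩
  · exact (hR.functional (hg _) (hf x)).2 rfl
  · exact (hR.functional (hf _) (hg y)).1 rfl
  · have := hfR _ (Formula.graph F) (Fin.cons (funMap F x) x)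
    rw [Formula.realize_graph] at this
    have h2 := this.2 rfl
    have h3 : (fun k => f ((Fin.cons (funMap F x) x : Fin (n + 1) → M) k)) =
        Fin.cons (f (funMap F x)) (f ∘ x) := by
      funext k
      refine Fin.cases ?_ (fun k => ?_) k <;> simp
    rw [h3, Formula.realize_graph] at h2
    exact h2.symm
  · exact hfR _ (r.formula Term.var) x
  · exact (hR.functional (hf r.1) hr).1 rfl

/-- A structure with a family of elementary relations. -/
structure ElementaryStage (L : FirstOrder.Language.{u, v}) (ι : Type) where
  /-- The underlying type. -/
  carrier : Type (max u v)
  [str : L.Structure carrier]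
  [nonempty : Nonempty carrier]
  /-- The relations. -/
  rel : ι → Set (carrier × carrier)
  elementary : ∀ i, IsElementaryRel L (rel i)

namespace ElementaryStage

attribute [instance] ElementaryStage.str ElementaryStage.nonempty

variable {L : FirstOrder.Language.{u, v}} {ι : Type}

/-- The stage with all relations reversed. -/
def swap (S : ElementaryStage L ι) : ElementaryStage L ι where
  carrier := S.carrier
  rel i := Prod.swap ⁻¹' S.rel i
  elementary i := (S.elementary i).swap

/-- With `e` and `f i` as in `exists_elementaryEmbedding_extending`, the pairs `(e x, f i x)` form
an elementary relation, since both maps are elementary; it extends the old one because `f i` agrees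
with `e` along it. -/
theorem exists_total (S : ElementaryStage L ι) :
    ∃ (S' : ElementaryStage L ι) (e : S.carrier ↪ₑ[L] S'.carrier),
      (∀ i x y, (x, y) ∈ S.rel i → (e x, e y) ∈ S'.rel i) ∧ ∀ i x, ∃ y, (e x, y) ∈ S'.rel i := by
  obtain ⟨N, _, _, e, f, hf⟩ := exists_elementaryEmbedding_extending S.rel S.elementary
  refine ⟨⟨N, fun i => Set.range fun x => (e x, f i x), fun i => isElementaryRel_of_forall
    fun ψ => ?_⟩, e, fun i x y h => ⟨x, ?_⟩, fun i x => ⟨f i x, x, rfl⟩⟩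
  · exact (e.map_formula ψ id).trans ((f i).map_formula ψ id).symm
  · simp only [hf i _ h]

theorem exists_total_surjective (S : ElementaryStage L ι) :
    ∃ (S' : ElementaryStage L ι) (e : S.carrier ↪ₑ[L] S'.carrier),
      (∀ i x y, (x, y) ∈ S.rel i → (e x, e y) ∈ S'.rel i) ∧
      ∀ i x, (∃ y, (e x, y) ∈ S'.rel i) ∧ ∃ y, (y, e x) ∈ S'.rel i := by
  obtain ⟨S₁, e₁, h₁, t₁⟩ := S.exists_total
  obtain ⟨S₂, e₂, h₂, t₂⟩ := S₁.swap.exists_total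
  refine ⟨S₂.swap, e₂.comp e₁, fun i x y h => h₂ i _ _ (h₁ i _ _ h), fun i x => ⟨?_, ?_⟩⟩
  · obtain ⟨y, hy⟩ := t₁ i x
    exact ⟨e₂ y, h₂ i y (e₁ x) hy⟩
  · exact t₂ i (e₁ x)

/-- An extension of `S` in which all relations are total and surjective on `S`. -/
noncomputable def next (S : ElementaryStage L ι) : ElementaryStage L ι :=
  S.exists_total_surjective.choose

/-- The inclusion of a stage in the next one. -/
noncomputable def toNext (S : ElementaryStage L ι) : S.carrier ↪ₑ[L] S.next.carrier :=
  S.exists_total_surjective.choose_spec.choose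

theorem toNext_rel (S : ElementaryStage L ι) {i : ι} {x y : S.carrier} (h : (x, y) ∈ S.rel i) :
    (S.toNext x, S.toNext y) ∈ S.next.rel i :=
  S.exists_total_surjective.choose_spec.choose_spec.1 i x y h

theorem toNext_total (S : ElementaryStage L ι) (i : ι) (x : S.carrier) :
    (∃ y, (S.toNext x, y) ∈ S.next.rel i) ∧ ∃ y, (y, S.toNext x) ∈ S.next.rel i :=
  S.exists_total_surjective.choose_spec.choose_spec.2 i x

/-- The chain of iterated extensions of a stage. -/
noncomputable def chain (S : ElementaryStage L ι) : ℕ → ElementaryStage L ι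
  | 0 => S
  | n + 1 => (S.chain n).next

end ElementaryStage

/-- Every family of elementary relations on `M` extends to a family of automorphisms of an
elementary extension of `M`. -/
theorem exists_automorphisms_extending {L : FirstOrder.Language.{u, v}} {M : Type (max u v)}
    [L.Structure M] [Nonempty M] {ι : Type} (R : ι → Set (M × M))
    (hR : ∀ i, IsElementaryRel L (R i)) :
    ∃ (N : Type (max u v)) (_ : L.Structure N) (e : M ↪ₑ[L] N) (σ : ι → N ≃[L] N),
      ∀ i, ∀ r ∈ R i, σ i (e r.1) = e r.2 := by
  let S : ElementaryStage L ι := ⟨M, R, hR⟩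
  let G : ℕ → Type (max u v) := fun n => (S.chain n).carrier
  let s : ∀ n, G n ↪[L] G (n + 1) := fun n => ((S.chain n).toNext).toEmbedding
  let f := DirectedSystem.natLERec s
  have hsucc : ∀ m n (h : m ≤ n) (x : G m),
      f m (n + 1) (h.trans n.le_succ) x = (S.chain n).toNext (f m n h x) := by
    intro m n h x
    simp only [f, DirectedSystem.coe_natLERec]
    rw [Nat.leRecOn_succ h]
    rfl
  have hself : ∀ m (x : G m), f m m le_rfl x = x := fun m x => by
    simp only [f, DirectedSystem.coe_natLERec, Nat.leRecOn_self]
  have hf : ∀ m n (h : m ≤ n), ∃ e : G m ↪ₑ[L] G n, ∀ x, e x = f m n h x := by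
    intro m n h
    induction n, h using Nat.le_induction with
    | base => exact ⟨ElementaryEmbedding.refl L _, fun x => (hself m x).symm⟩
    | succ n h ih =>
      obtain ⟨e, he⟩ := ih
      exact ⟨((S.chain n).toNext).comp e, fun x => by rw [hsucc m n h, ← he]; rfl⟩
  have hrel : ∀ m n (h : m ≤ n) i x y, (x, y) ∈ (S.chain m).rel i →
      (f m n h x, f m n h y) ∈ (S.chain n).rel i := by
    intro m n h i x y hxy
    induction n, h using Nat.le_induction with
    | base => rwa [hself, hself]
    | succ n h ih =>
      rw [hsucc m n h, hsucc m n h]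
      exact (S.chain n).toNext_rel ih
  let N := Language.DirectLimit G f
  let c : ∀ n, G n ↪ₑ[L] N := directLimitOf f hf
  have hc : ∀ m n (h : m ≤ n) x, c n (f m n h x) = c m x := fun m n h x => DirectLimit.of_f
  have hcs : ∀ n x, c (n + 1) ((S.chain n).toNext x) = c n x := fun n x => by
    rw [← hc n (n + 1) n.le_succ, hsucc n n le_rfl, hself]
  have hex : ∀ x : N, ∃ n y, c n y = x := fun x => DirectLimit.exists_of x
  -- The union of the relations of all stages is total and surjective, because each element of stage
  -- `n` acquires an image and a preimage at stage `n + 1`.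
  let Q : ι → Set (N × N) := fun i => {p | ∃ n x y, (x, y) ∈ (S.chain n).rel i ∧ p = (c n x, c n y)}
  have hQ : ∀ i, IsElementaryRel L (Q i) := by
    intro i k p hp ψ
    choose n x y hxy hpe using hp
    obtain ⟨m, hm⟩ := Finite.bddAbove_range n
    have hm' : ∀ j, n j ≤ m := fun j => hm ⟨j, rfl⟩
    have := (S.chain m).elementary i k (fun j => (f _ m (hm' j) (x j), f _ m (hm' j) (y j)))
      (fun j => hrel _ m (hm' j) i _ _ (hxy j)) ψ
    rw [← (c m).map_formula, ← (c m).map_formula] at this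
    simpa only [hpe, Function.comp_def, hc] using this
  have hσ : ∀ i, ∃ σ : N ≃[L] N, ∀ r ∈ Q i, σ r.1 = r.2 := by
    refine fun i => (hQ i).exists_equiv (fun x => ?_) fun x => ?_
    · obtain ⟨n, x, rfl⟩ := hex x
      obtain ⟨y, hy⟩ := ((S.chain n).toNext_total i x).1
      exact ⟨c (n + 1) y, n + 1, _, y, hy, by rw [hcs]⟩
    · obtain ⟨n, x, rfl⟩ := hex x
      obtain ⟨y, hy⟩ := ((S.chain n).toNext_total i x).2
      exact ⟨c (n + 1) y, n + 1, y, _, hy, by rw [hcs]⟩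
  choose σ hσ using hσ
  exact ⟨N, inferInstance, c 0, σ, fun i r hr => hσ i (c 0 r.1, c 0 r.2) ⟨0, r.1, r.2, hr, rfl⟩⟩

/-- A finite form of the non-existence of tuples conjugate under automorphisms: if in all
structures elementarily equivalent to `M` no tuple satisfies the formulas `γ` while its subtuples
`s i` and `t i` are conjugate for all `i`, then in `M` no tuple satisfies `γ` while `s i` and `t i`
agree on finitely many suitable formulas. -/
theorem exists_finset_formulas_of_automorphisms {L : FirstOrder.Language.{u, v}} {M : Type w}
    [L.Structure M] [Nonempty M] {β ι : Type} {κ : Type*} (γ : κ → L.Formula β)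
    {J : ι → Type} (s t : ∀ i, J i → β)
    (h : ∀ (N : Type (max u v)) [L.Structure N] [Nonempty N], (M ≅[L] N) → ∀ x : β → N,
      (∀ k, (γ k).Realize x) → ∀ σ : ι → N ≃[L] N, (∀ i j, σ i (x (s i j)) = x (t i j)) → False) :
    ∃ Θ : Finset (Σ i, L.Formula (J i)), ∀ x : β → M, (∀ k, (γ k).Realize x) →
      (∀ θ ∈ Θ, (θ.2.Realize (x ∘ s θ.1) ↔ θ.2.Realize (x ∘ t θ.1))) → False := by
  classical
  by_contra! hcon
  -- If no finite set works, compactness yields a tuple for which `s i` and `t i` have the same type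
  -- for every `i`; an elementary extension then makes them conjugate.
  let φ : κ ⊕ (Σ i, L.Formula (J i)) → L.Formula β :=
    Sum.elim γ fun θ => (θ.2.relabel (s θ.1)).iff (θ.2.relabel (t θ.1))
  obtain ⟨N, _, _, hMN, x, hx⟩ := exists_realize_of_forall_finset (M := M) φ (by
    intro S
    obtain ⟨x, hx, hxΘ, -⟩ := hcon S.toRight
    refine ⟨x, ?_⟩
    rintro (k | θ) hk
    · exact hx k
    · simp only [φ, Sum.elim_inr, Formula.realize_iff, Formula.realize_relabel]
      exact hxΘ θ (by simpa using hk))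
  obtain ⟨N', _, e, σ, hσ⟩ := exists_automorphisms_extending
    (fun i => Set.range fun j => (x (s i j), x (t i j))) (fun i => isElementaryRel_of_forall
      fun ψ => by
        have := hx (Sum.inr ⟨i, ψ⟩)
        simpa only [φ, Sum.elim_inr, Formula.realize_iff, Formula.realize_relabel,
          Function.comp_def] using this)
  have hNN' := e.elementarilyEquivalent
  have := hNN'.nonempty
  exact h N' (hMN.trans hNN') (e ∘ x) (fun k => (e.map_formula _ _).2 (hx (Sum.inl k))) σ
    fun i j => hσ i _ ⟨j, rfl⟩

/-! ### Groups of order automorphisms closed under gluing -/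

section Glue

variable {α : Type*} [LinearOrder α]

/-- A group of order automorphisms is closed under gluing if for each of its members `f` preserving
an initial part `C`, the map that is `f` on `C` and the identity off `C` belongs to the group. -/
def IsGlueClosed (G : Subgroup (α ≃o α)) : Prop :=
  ∀ C : Set α, IsLowerSet C → ∀ f ∈ G, (∀ x, f x ∈ C ↔ x ∈ C) →
    ∃ g ∈ G, (∀ x ∈ C, g x = f x) ∧ ∀ x ∉ C, g x = x

variable {G : Subgroup (α ≃o α)}

/-- Gluing on the other side: divide `f` by the map that agrees with `f` on `C`. -/
theorem IsGlueClosed.exists_eq_off (hG : IsGlueClosed G) {C : Set α} (hC : IsLowerSet C)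
    {f : α ≃o α} (hf : f ∈ G) (hfC : ∀ x, f x ∈ C ↔ x ∈ C) :
    ∃ g ∈ G, (∀ x ∈ C, g x = x) ∧ ∀ x ∉ C, g x = f x := by
  obtain ⟨g, hg, hgC, hgC'⟩ := hG C hC f hf hfC
  refine ⟨f * g⁻¹, mul_mem hf (inv_mem hg), fun x hx => ?_, fun x hx => ?_⟩
  · obtain ⟨y, rfl⟩ := f.surjective x
    rw [hfC] at hx
    rw [RelIso.mul_apply, ← hgC y hx, RelIso.inv_apply_self, hgC y hx]
  · rw [RelIso.mul_apply]
    congr 1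
    conv_lhs => rw [← hgC' x hx]
    rw [RelIso.inv_apply_self]

/-- The union of the preimages of `C` under the iterates of `h` works. Gluing needs a cut that is
exactly invariant, and this supplies one between two sets that are only moved in the right
directions. -/
theorem exists_invariant_lowerSet (h : α ≃o α) {C D : Set α} (hC : IsLowerSet C)
    (hCD : C ⊆ D) (hhC : ∀ x ∈ C, h x ∈ C) (hhD : ∀ x, h x ∈ D → x ∈ D) :
    ∃ E : Set α, IsLowerSet E ∧ C ⊆ E ∧ E ⊆ D ∧ ∀ x, h x ∈ E ↔ x ∈ E := by
  refine ⟨{x | ∃ n : ℕ, h^[n] x ∈ C}, ?_, fun x hx => ⟨0, hx⟩, ?_, fun x => ⟨?_, ?_⟩⟩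
  · rintro x y hyx ⟨n, hn⟩
    exact ⟨n, hC (h.monotone.iterate n hyx) hn⟩
  · rintro x ⟨n, hn⟩
    induction n generalizing x with
    | zero => exact hCD hn
    | succ n ih => exact hhD x (ih hn)
  · rintro ⟨n, hn⟩
    exact ⟨n + 1, hn⟩
  · rintro ⟨n, hn⟩
    refine ⟨n, ?_⟩
    rw [← Function.iterate_succ_apply, Function.iterate_succ_apply']
    exact hhC _ hn

theorem isLowerSet_preimage_orderIso {C : Set α} (hC : IsLowerSet C) (g : α ≃o α) :
    IsLowerSet {x | g x ∈ C} := fun _ _ hyx hx => hC (g.monotone hyx) hx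

/-- Corrects `g` near the lower cut `C` without changing it at `x₀`. If `g` moves `C` upwards, then
`g⁻¹ * f` maps `C` into itself and does not lower `x₀`, so `f` below an invariant cut can be glued
to `g` above it. If `g` moves `C` downwards, the identity replaces `f`. -/
theorem IsGlueClosed.exists_preserving_lower (hG : IsGlueClosed G) {f g : α ≃o α} (hf : f ∈ G)
    (hg : g ∈ G) {C D : Set α} (hC : IsLowerSet C) {x₀ : α} (hx₀ : x₀ ∉ C)
    (hfC : ∀ x, f x ∈ C ↔ x ∈ C) (hfD : ∀ x, f x ∈ D ↔ x ∈ D) (hgD : ∀ x, g x ∈ D ↔ x ∈ D)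
    (h₀ : x₀ ≤ g x₀) (h₁ : g x₀ ≤ f x₀) :
    ∃ k ∈ G, (∀ x, k x ∈ C ↔ x ∈ C) ∧ (∀ x, k x ∈ D ↔ x ∈ D) ∧ k x₀ = g x₀ := by
  have hCx : C ⊆ Set.Iio x₀ := fun x hx => lt_of_not_ge fun h => hx₀ (hC h hx)
  rcases (isLowerSet_preimage_orderIso hC g).total hC with hgC | hgC
  · have hh : ∀ x, g ((g⁻¹ * f) x) = f x := fun x => by
      rw [RelIso.mul_apply, RelIso.apply_inv_self]
    obtain ⟨E, hE, hCE, hEx, hhE⟩ := exists_invariant_lowerSet (g⁻¹ * f) hC hCx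
      (fun x hx => hgC (by
        change g ((g⁻¹ * f) x) ∈ C
        rw [hh, hfC]; exact hx))
      (fun x hx => lt_of_not_ge fun hge => by
        have h2 : g ((g⁻¹ * f) x) < g x₀ := g.strictMono hx
        rw [hh] at h2
        exact h₁.not_gt ((f.monotone hge).trans_lt h2))
    obtain ⟨h', hh', hh'E, hh'E'⟩ := hG E hE _ (mul_mem (inv_mem hg) hf) hhE
    refine ⟨g * h', mul_mem hg hh', fun x => ?_, fun x => ?_, ?_⟩
    · rw [RelIso.mul_apply]
      by_cases hx : x ∈ E
      · rw [hh'E x hx, hh, hfC]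
      · rw [hh'E' x hx]
        exact ⟨fun h => hgC h, fun h => absurd (hCE h) hx⟩
    · rw [RelIso.mul_apply]
      by_cases hx : x ∈ E
      · rw [hh'E x hx, hh, hfD]
      · rw [hh'E' x hx, hgD]
    · rw [RelIso.mul_apply, hh'E' x₀ fun h => lt_irrefl _ (hEx h)]
  · obtain ⟨E, hE, hCE, hEx, hhE⟩ := exists_invariant_lowerSet g hC hCx (fun x hx => hgC hx)
      (fun x hx => lt_of_not_ge fun hge => (h₀.trans (g.monotone hge)).not_gt hx)
    obtain ⟨k, hk, hkE, hkE'⟩ := hG.exists_eq_off hE hg hhE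
    refine ⟨k, hk, fun x => ?_, fun x => ?_, hkE' x₀ fun h => lt_irrefl _ (hEx h)⟩
    · by_cases hx : x ∈ E
      · rw [hkE x hx]
      · rw [hkE' x hx]
        exact ⟨fun h => absurd ((hhE x).1 (hCE h)) hx, fun h => absurd (hCE h) hx⟩
    · by_cases hx : x ∈ E
      · rw [hkE x hx]
      · rw [hkE' x hx, hgD]

/-- The same correction near an upper cut. The result is `g` up to a cut above `x₀`; beyond it, the
result is `f` if `g` moves `D` upwards, and the identity if `g` moves `D` downwards. -/
theorem IsGlueClosed.exists_preserving_upper (hG : IsGlueClosed G) {f g : α ≃o α} (hf : f ∈ G)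
    (hg : g ∈ G) {D : Set α} (hD : IsLowerSet D) {x₀ : α} (hx₀ : f x₀ ∈ D)
    (hfD : ∀ x, f x ∈ D ↔ x ∈ D) (h₀ : x₀ ≤ g x₀) (h₁ : g x₀ ≤ f x₀) :
    ∃ k ∈ G, (∀ x, k x ∈ D ↔ x ∈ D) ∧ k x₀ = g x₀ := by
  rcases (isLowerSet_preimage_orderIso hD g).total hD with hgD | hgD
  · have hfh : ∀ x, f ((f⁻¹ * g) x) = g x := fun x => by
      rw [RelIso.mul_apply, RelIso.apply_inv_self]
    obtain ⟨E, hE, hxE, hED, hhE⟩ := exists_invariant_lowerSet (f⁻¹ * g) (isLowerSet_Iic x₀)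
      (D := D) (fun x hx => hD (le_trans (Set.mem_Iic.1 hx) (h₀.trans h₁)) hx₀)
      (fun x hx => by
        rw [Set.mem_Iic, ← f.le_iff_le, hfh]
        exact (g.monotone hx).trans h₁)
      (fun x hx => hgD (by
        change g x ∈ D
        rw [← hfh, hfD]; exact hx))
    obtain ⟨h', hh', hh'E, hh'E'⟩ := hG.exists_eq_off hE (mul_mem (inv_mem hg) hf)
      (f := g⁻¹ * f) (fun x => by
        rw [← hhE]
        simp only [RelIso.mul_apply, RelIso.apply_inv_self, RelIso.inv_apply_self])
    refine ⟨g * h', mul_mem hg hh', fun x => ?_, ?_⟩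
    · rw [RelIso.mul_apply]
      by_cases hx : x ∈ E
      · rw [hh'E x hx, ← hfh, hfD]
        exact ⟨fun _ => hED hx, fun _ => hED ((hhE x).2 hx)⟩
      · rw [hh'E' x hx, RelIso.mul_apply, RelIso.apply_inv_self, hfD]
    · rw [RelIso.mul_apply, hh'E x₀ (hxE le_rfl)]
  · have hfinv : ∀ x, f⁻¹ x ∈ D ↔ x ∈ D := fun x => by
      rw [← hfD, RelIso.apply_inv_self]
    have hh : ∀ x, (f * g⁻¹ * f⁻¹) (f (g x)) = f x := fun x => by
      simp only [RelIso.mul_apply, RelIso.inv_apply_self]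
    obtain ⟨E, hE, hxE, hED, hhE⟩ := exists_invariant_lowerSet (f * g⁻¹ * f⁻¹)
      (isLowerSet_Iic (f x₀)) (D := D) (fun x hx => hD hx hx₀)
      (fun x hx => by
        have h2 : (f * g⁻¹ * f⁻¹) x ≤ (f * g⁻¹ * f⁻¹) (f (g x₀)) :=
          (f * g⁻¹ * f⁻¹).monotone (le_trans hx (f.monotone h₀))
        rw [hh] at h2
        exact h2)
      (fun x hx => by
        simp only [RelIso.mul_apply] at hx
        rw [hfD] at hx
        have := hgD hx
        simp only [Set.mem_ofPred_eq, RelIso.apply_inv_self] at this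
        rwa [hfinv] at this)
    obtain ⟨h', hh', hh'E, hh'E'⟩ := hG.exists_eq_off hE
      (mul_mem (mul_mem hf (inv_mem hg)) (inv_mem hf)) hhE
    refine ⟨g * f⁻¹ * h' * f, mul_mem (mul_mem (mul_mem hg (inv_mem hf)) hh') hf,
      fun x => ?_, ?_⟩
    · simp only [RelIso.mul_apply]
      by_cases hx : f x ∈ E
      · rw [hh'E _ hx, RelIso.inv_apply_self]
        have hxD : x ∈ D := (hfD x).1 (hED hx)
        exact ⟨fun _ => hxD, fun _ => hgD hxD⟩
      · rw [hh'E' _ hx]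
        simp only [RelIso.mul_apply, RelIso.inv_apply_self, RelIso.apply_inv_self]
    · simp only [RelIso.mul_apply]
      rw [hh'E _ (hxE le_rfl), RelIso.inv_apply_self]

/-- The orbits of a pointwise stabilizer are convex in the orbits of the group. -/
theorem IsGlueClosed.exists_fixing (hG : IsGlueClosed G) {f g : α ≃o α} (hf : f ∈ G)
    (hg : g ∈ G) {A : Set α} (hfA : ∀ a ∈ A, f a = a) {x₀ : α} (h₀ : x₀ < g x₀)
    (h₁ : g x₀ < f x₀) : ∃ k ∈ G, (∀ a ∈ A, k a = a) ∧ k x₀ = g x₀ := by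
  -- `C` and `D` are the cuts that `A` makes just below and just above `x₀`. Since `f` fixes `A`, it
  -- preserves both.
  let C : Set α := {y | ∃ a ∈ A, a < x₀ ∧ y ≤ a}
  let D : Set α := {y | ∀ a ∈ A, x₀ < a → y < a}
  have hC : IsLowerSet C := fun x y hyx ⟨a, ha, hax, hx⟩ => ⟨a, ha, hax, hyx.trans hx⟩
  have hD : IsLowerSet D := fun x y hyx hx a ha hax => hyx.trans_lt (hx a ha hax)
  have hle : ∀ a ∈ A, ∀ y, f y ≤ a ↔ y ≤ a := fun a ha y => by
    conv_lhs => rw [← hfA a ha]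
    exact f.le_iff_le
  have hlt : ∀ a ∈ A, ∀ y, f y < a ↔ y < a := fun a ha y => by
    conv_lhs => rw [← hfA a ha]
    exact f.lt_iff_lt
  have hfC : ∀ x, f x ∈ C ↔ x ∈ C := fun x =>
    exists_congr fun a => and_congr_right fun ha => by rw [hle a ha]
  have hfD : ∀ x, f x ∈ D ↔ x ∈ D := fun x =>
    forall₂_congr fun a ha => by rw [hlt a ha]
  have hx₀C : x₀ ∉ C := fun ⟨a, ha, hax, hx⟩ => hx.not_gt hax
  have hx₀D : x₀ ∈ D := fun a ha hax => hax
  obtain ⟨g', hg', hg'D, hg'x⟩ := hG.exists_preserving_upper hf hg hD ((hfD x₀).2 hx₀D) hfD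
    h₀.le h₁.le
  rw [← hg'x] at h₀ h₁ ⊢
  obtain ⟨k, hk, hkC, hkD, hkx⟩ := hG.exists_preserving_lower hf hg' hC hx₀C hfC hfD hg'D
    h₀.le h₁.le
  rw [← hkx]
  -- Once both cuts are preserved, `k` may be replaced by the identity on `C` and off `D`; this
  -- fixes all of `A`, as `x₀ ∉ A`.
  obtain ⟨k₁, hk₁, hk₁C, hk₁C'⟩ := hG.exists_eq_off hC hk hkC
  obtain ⟨k₂, hk₂, hk₂D, hk₂D'⟩ := hG D hD k₁ hk₁ fun x => by
    by_cases hx : x ∈ C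
    · rw [hk₁C x hx]
    · rw [hk₁C' x hx, hkD]
  refine ⟨k₂, hk₂, fun a ha => ?_, ?_⟩
  · by_cases haD : a ∈ D
    · rw [hk₂D a haD]
      rcases lt_trichotomy a x₀ with h | rfl | h
      · exact hk₁C a ⟨a, ha, h, le_rfl⟩
      · exact absurd (hfA a ha) (h₀.trans h₁).ne'
      · exact absurd (haD a ha h) (lt_irrefl _)
    · exact hk₂D' a haD
  · rw [hk₂D x₀ hx₀D, hk₁C' x₀ hx₀C]

/-- After possibly inverting `f`, it moves `I` upwards. If no power of `f⁻¹` brought `b` into `I`,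
then `f` on the union of the `f ^ n`-images of `I`, glued to the identity, would fix `a` and `b` and
still move `I`. So some power does, and it is trimmed to the identity up to `a`. -/
theorem IsGlueClosed.exists_pushing_above (hG : IsGlueClosed G) {I : Set α} (hI : IsLowerSet I)
    {a b : α} (ha : a ∈ I)
    (hab : ∀ k ∈ G, k a = a → k b = b → ∀ x, k x ∈ I ↔ x ∈ I) {f : α ≃o α} (hf : f ∈ G)
    (hfa : f a = a) {y : α} (hy : ¬(f y ∈ I ↔ y ∈ I)) :
    ∃ F ∈ G, (∀ x ≤ a, F x = x) ∧ F⁻¹ b ∈ I := by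
  wlog hfI : ∀ x, f x ∈ I → x ∈ I generalizing f y with H
  · refine H (inv_mem hf) (y := f y) ?_ ?_ fun x hx => ?_
    · conv_lhs => rw [← hfa]
      rw [RelIso.inv_apply_self]
    · rwa [RelIso.inv_apply_self, iff_comm]
    · rcases (isLowerSet_preimage_orderIso hI f).total hI with h | h
      · exact absurd (fun x hx => h hx) hfI
      · simpa using h hx
  have hfI' : ∀ x ∈ I, f⁻¹ x ∈ I := fun x hx => hfI _ (by rwa [RelIso.apply_inv_self])
  have hbC : ∃ n : ℕ, (f⁻¹ ^ n) b ∈ I := by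
    by_contra hb
    let C : Set α := {x | ∃ n : ℕ, (f⁻¹ ^ n) x ∈ I}
    have hIC : I ⊆ C := fun x hx => ⟨0, hx⟩
    obtain ⟨k, hk, hkC, hkC'⟩ := hG C
      (fun x y hyx ⟨n, hn⟩ => ⟨n, hI ((f⁻¹ ^ n).monotone hyx) hn⟩) f hf (fun x => by
        constructor
        · rintro ⟨n, hn⟩
          refine ⟨n, ?_⟩
          have := hfI' _ hn
          rwa [← RelIso.mul_apply, ← pow_succ', pow_succ, RelIso.mul_apply,
            RelIso.inv_apply_self] at this
        · rintro ⟨n, hn⟩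
          refine ⟨n + 1, ?_⟩
          rwa [pow_succ, RelIso.mul_apply, RelIso.inv_apply_self])
    have := hab k hk (by rw [hkC a (hIC ha), hfa]) (hkC' b hb)
    by_cases hyI : y ∈ I
    · have h1 := this y
      rw [hkC y (hIC hyI)] at h1
      exact hy h1
    · exact hy ⟨fun h => hfI y h, fun h => absurd h hyI⟩
  obtain ⟨n, hn⟩ := hbC
  have hpow : ∀ n : ℕ, (f ^ n) a = a := fun n => by
    induction n with
    | zero => rfl
    | succ n ih => rw [pow_succ, RelIso.mul_apply, hfa, ih]
  obtain ⟨F, hF, hFa, hFa'⟩ := hG.exists_eq_off (isLowerSet_Iic a) (pow_mem hf n) (fun x => by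
    rw [Set.mem_Iic, Set.mem_Iic]
    conv_lhs => rw [← hpow n]
    exact (f ^ n).le_iff_le)
  refine ⟨F, hF, hFa, ?_⟩
  have hpn : (f ^ n) ((f⁻¹ ^ n) b) = b := by rw [inv_pow, RelIso.apply_inv_self]
  by_cases hle : (f⁻¹ ^ n) b ≤ a
  · have : b ≤ a := by
      have := (f ^ n).monotone hle
      rwa [hpn, hpow] at this
    have hFb : F⁻¹ b = b := by
      conv_lhs => rw [← hFa b this]
      rw [RelIso.inv_apply_self]
    rw [hFb]
    exact hI this ha
  · have h2 := hFa' _ hle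
    rw [hpn] at h2
    rwa [← h2, RelIso.inv_apply_self]

/-- Dual to `IsGlueClosed.exists_pushing_above`, with the largest `f`-invariant part of `I` in place
of the smallest invariant set containing `I`. -/
theorem IsGlueClosed.exists_pushing_below (hG : IsGlueClosed G) {I : Set α} (hI : IsLowerSet I)
    {a b : α} (hb : b ∉ I)
    (hab : ∀ k ∈ G, k a = a → k b = b → ∀ x, k x ∈ I ↔ x ∈ I) {f : α ≃o α} (hf : f ∈ G)
    (hfb : f b = b) {y : α} (hy : ¬(f y ∈ I ↔ y ∈ I)) :
    ∃ F ∈ G, (∀ x ≥ b, F x = x) ∧ F⁻¹ a ∉ I := by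
  wlog hfI : ∀ x ∈ I, f x ∈ I generalizing f y with H
  · refine H (inv_mem hf) (y := f y) ?_ ?_ fun x hx => ?_
    · conv_lhs => rw [← hfb]
      rw [RelIso.inv_apply_self]
    · rwa [RelIso.inv_apply_self, iff_comm]
    · rcases (isLowerSet_preimage_orderIso hI f).total hI with h | h
      · exact h (by simpa using hx)
      · exact absurd (fun x hx => h hx) hfI
  have haC : ∃ n : ℕ, (f⁻¹ ^ n) a ∉ I := by
    by_contra! ha
    let C : Set α := {x | ∀ n : ℕ, (f⁻¹ ^ n) x ∈ I}
    have hCI : C ⊆ I := fun x hx => hx 0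
    obtain ⟨k, hk, hkC, hkC'⟩ := hG.exists_eq_off (C := C)
      (fun x y hyx hn n => hI ((f⁻¹ ^ n).monotone hyx) (hn n)) hf (fun x => by
        constructor
        · intro hn n
          have := hn (n + 1)
          rwa [pow_succ, RelIso.mul_apply, RelIso.inv_apply_self] at this
        · intro hn n
          cases n with
          | zero => exact hfI x (hn 0)
          | succ n =>
            rw [pow_succ, RelIso.mul_apply, RelIso.inv_apply_self]
            exact hn n)
    have := hab k hk (hkC a ha) (by rw [hkC' b fun h => hb (hCI h), hfb])
    by_cases hyI : y ∈ I
    · exact hy ⟨fun _ => hyI, fun _ => hfI y hyI⟩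
    · have h1 := this y
      rw [hkC' y fun h => hyI (hCI h)] at h1
      exact hy h1
  obtain ⟨n, hn⟩ := haC
  have hpow : ∀ n : ℕ, (f ^ n) b = b := fun n => by
    induction n with
    | zero => rfl
    | succ n ih => rw [pow_succ, RelIso.mul_apply, hfb, ih]
  obtain ⟨F, hF, hFb, hFb'⟩ := hG _ (isLowerSet_Iio b) _ (pow_mem hf n) (fun x => by
    rw [Set.mem_Iio, Set.mem_Iio]
    conv_lhs => rw [← hpow n]
    exact (f ^ n).lt_iff_lt)
  have hFb' : ∀ x ≥ b, F x = x := fun x hx => hFb' x hx.not_gt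
  refine ⟨F, hF, hFb', ?_⟩
  have hpn : (f ^ n) ((f⁻¹ ^ n) a) = a := by rw [inv_pow, RelIso.apply_inv_self]
  by_cases hle : (f⁻¹ ^ n) a < b
  · have h2 := hFb _ hle
    rw [hpn] at h2
    rwa [← h2, RelIso.inv_apply_self]
  · have : b ≤ a := by
      have := (f ^ n).monotone (not_lt.1 hle)
      rwa [hpn, hpow] at this
    have hFa : F⁻¹ a = a := by
      conv_lhs => rw [← hFb' a this]
      rw [RelIso.inv_apply_self]
    rw [hFa]
    exact fun h => hb (hI this h)

/-- An initial part fixed by the stabilizer of two points around its end is fixed by the stabilizer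
of one of them. -/
theorem IsGlueClosed.preserves_of_pair (hG : IsGlueClosed G) {I : Set α} (hI : IsLowerSet I)
    {a b : α} (ha : a ∈ I) (hb : b ∉ I)
    (hab : ∀ k ∈ G, k a = a → k b = b → ∀ x, k x ∈ I ↔ x ∈ I) :
    (∀ k ∈ G, k a = a → ∀ x, k x ∈ I ↔ x ∈ I) ∨ ∀ k ∈ G, k b = b → ∀ x, k x ∈ I ↔ x ∈ I := by
  by_contra! hcon
  obtain ⟨⟨f, hf, hfa, y, hy⟩, h, hh, hhb, z, hz⟩ := hcon
  obtain ⟨F, hF, hFa, hFb⟩ := hG.exists_pushing_above hI ha hab hf hfa (y := y) (by tauto)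
  obtain ⟨H, hH, hHb, hHa⟩ := hG.exists_pushing_below hI hb hab hh hhb (y := z) (by tauto)
  have hFinv : ∀ x ≤ a, F⁻¹ x = x := fun x hx => by
    conv_lhs => rw [← hFa x hx]
    rw [RelIso.inv_apply_self]
  have hHinv : ∀ x ≥ b, H⁻¹ x = x := fun x hx => by
    conv_lhs => rw [← hHb x hx]
    rw [RelIso.inv_apply_self]
  have hlt : ∀ {x y}, x ∈ I → y ∉ I → x < y := fun hx hy => lt_of_not_ge fun h => hy (hI h hx)
  have hHa' : H a ≤ a := by
    have := H.monotone (hlt ha hHa).le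
    rwa [RelIso.apply_inv_self] at this
  have hFb' : b ≤ F b := by
    have := F.monotone (hlt hFb hb).le
    rwa [RelIso.apply_inv_self] at this
  -- `F` is the identity up to `a` and `H` from `b` on, so their commutator fixes `a` and `b` and
  -- must preserve `I`. Yet it sends `F⁻¹ (H⁻¹ a)`, which lies below `F⁻¹ b ∈ I`, to `H⁻¹ a ∉ I`.
  have key := hab (H⁻¹ * F⁻¹ * H * F)
    (mul_mem (mul_mem (mul_mem (inv_mem hH) (inv_mem hF)) hH) hF)
    (by simp only [RelIso.mul_apply]
        rw [hFa a le_rfl, hFinv _ hHa', RelIso.inv_apply_self])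
    (by simp only [RelIso.mul_apply]
        rw [hHb _ hFb', RelIso.inv_apply_self, hHinv b le_rfl])
    (F⁻¹ (H⁻¹ a))
  simp only [RelIso.mul_apply, RelIso.apply_inv_self, hFinv a le_rfl] at key
  refine hHa (key.2 (hI ?_ hFb))
  refine F⁻¹.monotone ?_
  have := H⁻¹.monotone (hlt ha hb).le
  rwa [hHinv b le_rfl] at this

/-- An initial part fixed by the stabilizer of a finite set is fixed by the stabilizer of one of
its points. -/
theorem IsGlueClosed.preserves_of_finset (hG : IsGlueClosed G) {I : Set α} (hI : IsLowerSet I)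
    {A : Finset α} (hA : A.Nonempty)
    (hfix : ∀ k ∈ G, (∀ a ∈ A, k a = a) → ∀ x, k x ∈ I ↔ x ∈ I) :
    ∃ a ∈ A, ∀ k ∈ G, k a = a → ∀ x, k x ∈ I ↔ x ∈ I := by
  classical
  -- Only the last point of `A` in `I` and the first point outside matter: a map fixing the former
  -- can be made the identity below it without changing its effect on `I`.
  have hlow : ∀ a, (∀ c ∈ A, c ∈ I → c ≤ a) → a ∈ I → ∀ k ∈ G, k a = a → ∃ k' ∈ G,
      (∀ c ∈ A, c ∈ I → k' c = c) ∧ (∀ x, k' x ∈ I ↔ k x ∈ I) ∧ ∀ c, k c = c → k' c = c := by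
    intro a ha haI k hk hka
    obtain ⟨k', hk', h1, h2⟩ := hG.exists_eq_off (isLowerSet_Iic a) hk (fun x => by
      rw [Set.mem_Iic, Set.mem_Iic]
      conv_lhs => rw [← hka]
      exact k.le_iff_le)
    refine ⟨k', hk', fun c hc hcI => h1 c (ha c hc hcI), fun x => ?_, fun c hc => ?_⟩
    · by_cases hx : x ≤ a
      · rw [h1 x hx]
        have : k x ≤ a := by
          rw [← hka]; exact k.monotone hx
        exact ⟨fun _ => hI this haI, fun _ => hI hx haI⟩
      · rw [h2 x hx]
    · by_cases hx : c ≤ a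
      · exact h1 c hx
      · rw [h2 c hx, hc]
  have hupp : ∀ b, (∀ c ∈ A, c ∉ I → b ≤ c) → b ∉ I → ∀ k ∈ G, k b = b → ∃ k' ∈ G,
      (∀ c ∈ A, c ∉ I → k' c = c) ∧ (∀ x, k' x ∈ I ↔ k x ∈ I) ∧ ∀ c, k c = c → k' c = c := by
    intro b hb hbI k hk hkb
    obtain ⟨k', hk', h1, h2⟩ := hG _ (isLowerSet_Iio b) k hk (fun x => by
      rw [Set.mem_Iio, Set.mem_Iio]
      conv_lhs => rw [← hkb]
      exact k.lt_iff_lt)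
    refine ⟨k', hk', fun c hc hcI => h2 c (hb c hc hcI).not_gt, fun x => ?_, fun c hc => ?_⟩
    · by_cases hx : x < b
      · rw [h1 x hx]
      · rw [h2 x hx]
        have : b ≤ k x := by
          conv_lhs => rw [← hkb]
          exact k.monotone (not_lt.1 hx)
        exact ⟨fun h => absurd (hI (not_lt.1 hx) h) hbI, fun h => absurd (hI this h) hbI⟩
    · by_cases hx : c < b
      · rw [h1 c hx, hc]
      · exact h2 c hx
  have hmax : (A.filter (· ∈ I)).Nonempty →
      ∃ a ∈ A, a ∈ I ∧ ∀ c ∈ A, c ∈ I → c ≤ a := fun h => by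
    have := Finset.max'_mem _ h
    rw [Finset.mem_filter] at this
    exact ⟨_, this.1, this.2, fun c hc hcI => Finset.le_max' _ _ (Finset.mem_filter.2 ⟨hc, hcI⟩)⟩
  have hmin : (A.filter (· ∉ I)).Nonempty →
      ∃ a ∈ A, a ∉ I ∧ ∀ c ∈ A, c ∉ I → a ≤ c := fun h => by
    have := Finset.min'_mem _ h
    rw [Finset.mem_filter] at this
    exact ⟨_, this.1, this.2, fun c hc hcI => Finset.min'_le _ _ (Finset.mem_filter.2 ⟨hc, hcI⟩)⟩
  rcases (A.filter (· ∈ I)).eq_empty_or_nonempty with h1 | h1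
  · have hnot : ∀ c ∈ A, c ∉ I := fun c hc hcI => by
      have := Finset.mem_filter.2 ⟨hc, hcI⟩
      rw [h1] at this
      simp at this
    obtain ⟨c, hc⟩ := hA
    obtain ⟨b, hbA, hbI, hb⟩ := hmin ⟨c, Finset.mem_filter.2 ⟨hc, hnot c hc⟩⟩
    refine ⟨b, hbA, fun k hk hkb x => ?_⟩
    obtain ⟨k', hk', h2, h3, -⟩ := hupp b hb hbI k hk hkb
    rw [← h3]
    exact hfix k' hk' (fun a ha => h2 a ha (hnot a ha)) x
  · obtain ⟨a, haA, haI, ha⟩ := hmax h1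
    rcases (A.filter (· ∉ I)).eq_empty_or_nonempty with h2 | h2
    · have hin : ∀ c ∈ A, c ∈ I := fun c hc => by
        by_contra hcI
        have : c ∈ A.filter (· ∉ I) := Finset.mem_filter.2 ⟨hc, hcI⟩
        rw [h2] at this
        simp at this
      refine ⟨a, haA, fun k hk hka x => ?_⟩
      obtain ⟨k', hk', h2, h3, -⟩ := hlow a ha haI k hk hka
      rw [← h3]
      exact hfix k' hk' (fun a ha => h2 a ha (hin a ha)) x
    · obtain ⟨b, hbA, hbI, hb⟩ := hmin h2
      have := hG.preserves_of_pair hI haI hbI fun k hk hka hkb x => by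
        obtain ⟨k₁, hk₁, h4, h5, h6⟩ := hlow a ha haI k hk hka
        obtain ⟨k₂, hk₂, h7, h8, h9⟩ := hupp b hb hbI k₁ hk₁ (h6 b hkb)
        rw [← h5, ← h8]
        refine hfix k₂ hk₂ (fun c hc => ?_) x
        by_cases hcI : c ∈ I
        · exact h9 c (h4 c hc hcI)
        · exact h7 c hc hcI
      rcases this with h | h
      · exact ⟨a, haA, h⟩
      · exact ⟨b, hbA, h⟩

end Glue

/-! ### Automorphism groups of models -/

section Models

variable {L : FirstOrder.Language.{u, v}} {lt : L.Relations 2} {T : L.Theory}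

theorem IsTheoryOfLinearOrders.exists_linearOrder (hlinear : IsTheoryOfLinearOrders lt T)
    (N : Type (max u v)) [L.Structure N] [Nonempty N] [T.Model N] :
    ∃ _ : LinearOrder N, InterpretsLT lt N := by
  classical
  have := hlinear (Theory.ModelType.of T N)
  exact ⟨@linearOrderOfSTO N (fun a b => RelMap lt ![a, b]) this _, fun a b => Iff.rfl⟩

theorem InterpretsLT.realize_lt {N : Type w} [L.Structure N] [LinearOrder N]
    (h : InterpretsLT lt N) {α : Type*} (i j : α) (x : α → N) :
    (lt.formula₂ (Term.var i) (Term.var j) : L.Formula α).Realize x ↔ x i < x j := by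
  rw [Formula.realize_rel₂, Term.realize_var, Term.realize_var, h]

/-- The group of order automorphisms that are automorphisms of the `L`-structure. -/
def autGroup (L : FirstOrder.Language.{u, v}) (N : Type w) [L.Structure N] [LinearOrder N] :
    Subgroup (N ≃o N) where
  carrier := {f | ∃ σ : N ≃[L] N, ∀ x, σ x = f x}
  one_mem' := ⟨Language.Equiv.refl L N, fun _ => rfl⟩
  mul_mem' := by
    rintro f g ⟨σ, hσ⟩ ⟨τ, hτ⟩
    exact ⟨σ.comp τ, fun x => by rw [Language.Equiv.comp_apply, hτ, hσ]; rfl⟩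
  inv_mem' := by
    rintro f ⟨σ, hσ⟩
    refine ⟨σ.symm, fun x => ?_⟩
    apply σ.injective
    rw [Language.Equiv.apply_symm_apply, hσ, RelIso.apply_inv_self]

section

variable {N : Type w} [L.Structure N] [LinearOrder N]

theorem realize_iff_of_mem_autGroup {f : N ≃o N} (hf : f ∈ autGroup L N) {α : Type*}
    (φ : L.Formula α) (x : α → N) : φ.Realize (fun i => f (x i)) ↔ φ.Realize x := by
  obtain ⟨σ, hσ⟩ := hf
  simp only [← hσ]
  exact StrongHomClass.realize_formula σ φ

theorem InterpretsLT.exists_mem_autGroup (h : InterpretsLT lt N) (σ : N ≃[L] N) :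
    ∃ f ∈ autGroup L N, ∀ x, f x = σ x := by
  have hlt : ∀ x y, σ x < σ y ↔ x < y := fun x y => by
    rw [← h, ← h]
    have := σ.map_rel lt ![x, y]
    rwa [show σ ∘ ![x, y] = ![σ x, σ y] by
      funext i; refine Fin.cases ?_ (fun i => ?_) i <;> simp] at this
  exact ⟨⟨σ.toEquiv, fun {x y} => by
    rw [← not_lt, ← not_lt]; exact not_congr (hlt y x)⟩, ⟨σ, fun _ => rfl⟩, fun _ => rfl⟩

end

theorem SLB.isGlueClosed (hSLB : SLB lt T) {N : Type (max u v)} [L.Structure N] [LinearOrder N]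
    [Nonempty N] [T.Model N] (h : InterpretsLT lt N) : IsGlueClosed (autGroup L N) := by
  rintro C hC f ⟨σ, hσ⟩ hfC
  obtain ⟨τ, hτ, hτ'⟩ := hSLB N h C hC σ (by
    ext y
    constructor
    · rintro ⟨x, hx, rfl⟩
      rw [hσ, hfC]; exact hx
    · intro hy
      obtain ⟨x, rfl⟩ := f.surjective y
      exact ⟨x, (hfC x).1 hy, hσ x⟩)
  obtain ⟨g, hg, hgτ⟩ := h.exists_mem_autGroup τ
  exact ⟨g, hg, fun x hx => by rw [hgτ, hτ x hx, hσ], fun x hx => by rw [hgτ, hτ' x hx]⟩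

/-! ### Consequences in arbitrary models -/

theorem comp_sumMap_const {α ι κ N : Type*} (z : α ⊕ ι → N) (c : ι) :
    z ∘ Sum.map id (fun _ : κ => c) = Sum.elim (z ∘ Sum.inl) fun _ => z (Sum.inr c) := by
  funext i
  cases i <;> rfl

variable {M : Type w} [L.Structure M] [LinearOrder M] [Nonempty M] [T.Model M]

/-- Finitely many formulas witness that types over a tuple are convex in types over the empty
set. -/
theorem exists_formulas_convex (hlinear : IsTheoryOfLinearOrders lt T) (hSLB : SLB lt T)
    (hM : InterpretsLT lt M) {n : ℕ} (φ : L.Formula (Fin n ⊕ Fin 1)) :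
    ∃ (Θ : Finset (L.Formula (Fin n ⊕ Fin 1))) (Δ : Finset (L.Formula (Fin 1))),
      ∀ (a : Fin n → M) (x y x' : M), x < y → y < x' →
        (∀ θ ∈ Θ, θ.Realize (Sum.elim a fun _ => x) ↔ θ.Realize (Sum.elim a fun _ => x')) →
        (∀ δ ∈ Δ, δ.Realize (fun _ => x) ↔ δ.Realize (fun _ => y)) →
        φ.Realize (Sum.elim a fun _ => x) → φ.Realize (Sum.elim a fun _ => y) := by
  classical
  let γ : Unit → L.Formula (Fin n ⊕ Fin 3) := fun _ =>
    (lt.formula₂ (Term.var (Sum.inr 0)) (Term.var (Sum.inr 1))) ⊓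
    ((lt.formula₂ (Term.var (Sum.inr 1)) (Term.var (Sum.inr 2))) ⊓
    ((φ.relabel (Sum.map id fun _ => 0)) ⊓ (φ.relabel (Sum.map id fun _ => 1)).not))
  -- Index `true` compares the types of `x` and `x'` over `a`. Index `false` compares those of `x`
  -- and `y` over the empty set: all its variables are sent to a single point.
  obtain ⟨Θ, hΘ⟩ := exists_finset_formulas_of_automorphisms (M := M) (ι := Bool) γ
    (J := fun _ => Fin n ⊕ Fin 1)
    (fun i => bif i then Sum.map id fun _ => 0 else fun _ => Sum.inr 0)
    (fun i => bif i then Sum.map id fun _ => 2 else fun _ => Sum.inr 1) (by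
      intro N _ _ hMN z hz σ hσ
      have := hMN.theory_model (T := T)
      obtain ⟨_, hN⟩ := hlinear.exists_linearOrder N
      have hz := hz ()
      simp only [γ, Formula.realize_inf, hN.realize_lt, Formula.realize_not,
        Formula.realize_relabel, comp_sumMap_const] at hz
      obtain ⟨h01, h12, h0, h1⟩ := hz
      obtain ⟨f, hf, hfσ⟩ := hN.exists_mem_autGroup (σ true)
      obtain ⟨g, hg, hgσ⟩ := hN.exists_mem_autGroup (σ false)
      have hf2 : f (z (Sum.inr 0)) = z (Sum.inr 2) := (hfσ _).trans (hσ true (Sum.inr 0))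
      have hg1 : g (z (Sum.inr 0)) = z (Sum.inr 1) := (hgσ _).trans (hσ false (Sum.inr 0))
      obtain ⟨k, hk, hka, hk1⟩ := (hSLB.isGlueClosed hN).exists_fixing hf hg
        (A := Set.range fun i => z (Sum.inl i)) (by
          rintro _ ⟨i, rfl⟩
          exact (hfσ _).trans (hσ true (Sum.inl i))) (x₀ := z (Sum.inr 0))
        (by rwa [hg1]) (by rwa [hf2, hg1])
      apply h1
      rw [← realize_iff_of_mem_autGroup hk] at h0
      convert h0 using 2 with i
      cases i with
      | inl i => exact (hka _ ⟨i, rfl⟩).symm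
      | inr i => exact (hk1.trans hg1).symm)
  refine ⟨Θ.image fun θ => θ.2, Θ.image fun θ => θ.2.relabel fun _ => 0, ?_⟩
  intro a x y x' hxy hyx' hθ hδ hx
  by_contra hy
  refine hΘ (Sum.elim a ![x, y, x']) (fun _ => ?_) fun θ hθm => ?_
  · simp only [γ, Formula.realize_inf, hM.realize_lt, Formula.realize_not,
      Formula.realize_relabel, comp_sumMap_const]
    exact ⟨hxy, hyx', hx, hy⟩
  · obtain ⟨i, θ⟩ := θ
    cases i with
    | true =>
      have := hθ θ (Finset.mem_image_of_mem (fun θ => θ.2) hθm)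
      simp only [cond_true, comp_sumMap_const]
      exact this
    | false =>
      have := hδ _ (Finset.mem_image_of_mem (fun θ => θ.2.relabel fun _ => (0 : Fin 1)) hθm)
      rw [Formula.realize_relabel, Formula.realize_relabel] at this
      exact this

/-- Over a point, elements below it are independent of elements above it. -/
theorem exists_formulas_below (hlinear : IsTheoryOfLinearOrders lt T) (hSLB : SLB lt T)
    (hM : InterpretsLT lt M) (ψ : L.Formula (Fin 2)) :
    ∃ Θ : Finset (L.Formula (Fin 2)), ∀ x y y' z : M, y ≤ x → y' ≤ x → x < z →
      (∀ θ ∈ Θ, θ.Realize ![x, y] ↔ θ.Realize ![x, y']) →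
      ψ.Realize ![y, z] → ψ.Realize ![y', z] := by
  classical
  let γ : Unit → L.Formula (Fin 4) := fun _ =>
    (lt.formula₂ (Term.var 0) (Term.var 1)).not ⊓ ((lt.formula₂ (Term.var 0) (Term.var 3)) ⊓
      ((ψ.relabel ![1, 3]) ⊓ (ψ.relabel ![2, 3]).not))
  obtain ⟨Θ, hΘ⟩ := exists_finset_formulas_of_automorphisms (M := M) (ι := Unit) γ
    (J := fun _ => Fin 2) (fun _ => ![0, 1]) (fun _ => ![0, 2]) (by
      intro N _ _ hMN z hz σ hσ
      have := hMN.theory_model (T := T)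
      obtain ⟨_, hN⟩ := hlinear.exists_linearOrder N
      have hz := hz ()
      simp only [γ, Formula.realize_inf, hN.realize_lt, Formula.realize_not,
        Formula.realize_relabel, not_lt] at hz
      obtain ⟨h10, h03, h1, h2⟩ := hz
      obtain ⟨f, hf, hfσ⟩ := hN.exists_mem_autGroup (σ ())
      have hf0 : f (z 0) = z 0 := (hfσ _).trans (hσ () 0)
      have hf1 : f (z 1) = z 2 := (hfσ _).trans (hσ () 1)
      -- The variables 0, 1, 2, 3 stand for `x, y, y', z`. The glued map takes `y` to `y'` and
      -- leaves `z`, which lies above `x`, in place.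
      obtain ⟨g, hg, hgC, hgC'⟩ := hSLB.isGlueClosed hN _ (isLowerSet_Iic (z 0)) f hf fun x => by
        rw [Set.mem_Iic, Set.mem_Iic]
        conv_lhs => rw [← hf0]
        exact f.le_iff_le
      apply h2
      rw [← realize_iff_of_mem_autGroup hg] at h1
      convert h1 using 2 with i
      fin_cases i
      · exact (hf1.symm.trans (hgC _ h10).symm)
      · exact (hgC' _ h03.not_ge).symm)
  refine ⟨Θ.image fun θ => θ.2, fun x y y' z hyx hy'x hxz hθ hψ => ?_⟩
  by_contra hn
  have hcomp : ∀ i j : Fin 4, (![x, y, y', z] ∘ ![i, j] : Fin 2 → M) =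
      ![(![x, y, y', z] : Fin 4 → M) i, (![x, y, y', z] : Fin 4 → M) j] := fun i j => by
    funext k; fin_cases k <;> rfl
  refine hΘ ![x, y, y', z] (fun _ => ?_) fun θ hθm => ?_
  · simp only [γ, Formula.realize_inf, hM.realize_lt, Formula.realize_not,
      Formula.realize_relabel, not_lt, hcomp]
    exact ⟨hyx, hxz, hψ, hn⟩
  · rw [hcomp, hcomp]
    exact hθ _ (Finset.mem_image_of_mem (fun θ => θ.2) hθm)

/-- Over a point, elements above it are independent of elements below it. -/
theorem exists_formulas_above (hlinear : IsTheoryOfLinearOrders lt T) (hSLB : SLB lt T)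
    (hM : InterpretsLT lt M) (ψ : L.Formula (Fin 2)) :
    ∃ Θ : Finset (L.Formula (Fin 2)), ∀ x y y' z : M, x ≤ y → x ≤ y' → z < x →
      (∀ θ ∈ Θ, θ.Realize ![x, y] ↔ θ.Realize ![x, y']) →
      ψ.Realize ![y, z] → ψ.Realize ![y', z] := by
  classical
  let γ : Unit → L.Formula (Fin 4) := fun _ =>
    (lt.formula₂ (Term.var 1) (Term.var 0)).not ⊓ ((lt.formula₂ (Term.var 3) (Term.var 0)) ⊓
      ((ψ.relabel ![1, 3]) ⊓ (ψ.relabel ![2, 3]).not))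
  obtain ⟨Θ, hΘ⟩ := exists_finset_formulas_of_automorphisms (M := M) (ι := Unit) γ
    (J := fun _ => Fin 2) (fun _ => ![0, 1]) (fun _ => ![0, 2]) (by
      intro N _ _ hMN z hz σ hσ
      have := hMN.theory_model (T := T)
      obtain ⟨_, hN⟩ := hlinear.exists_linearOrder N
      have hz := hz ()
      simp only [γ, Formula.realize_inf, hN.realize_lt, Formula.realize_not,
        Formula.realize_relabel, not_lt] at hz
      obtain ⟨h10, h03, h1, h2⟩ := hz
      obtain ⟨f, hf, hfσ⟩ := hN.exists_mem_autGroup (σ ())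
      have hf0 : f (z 0) = z 0 := (hfσ _).trans (hσ () 0)
      have hf1 : f (z 1) = z 2 := (hfσ _).trans (hσ () 1)
      obtain ⟨g, hg, hgC, hgC'⟩ := (hSLB.isGlueClosed hN).exists_eq_off (isLowerSet_Iio (z 0)) hf
        fun x => by
          rw [Set.mem_Iio, Set.mem_Iio]
          conv_lhs => rw [← hf0]
          exact f.lt_iff_lt
      apply h2
      rw [← realize_iff_of_mem_autGroup hg] at h1
      convert h1 using 2 with i
      fin_cases i
      · exact (hf1.symm.trans (hgC' _ h10.not_gt).symm)
      · exact (hgC _ h03).symm)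
  refine ⟨Θ.image fun θ => θ.2, fun x y y' z hyx hy'x hxz hθ hψ => ?_⟩
  by_contra hn
  have hcomp : ∀ i j : Fin 4, (![x, y, y', z] ∘ ![i, j] : Fin 2 → M) =
      ![(![x, y, y', z] : Fin 4 → M) i, (![x, y, y', z] : Fin 4 → M) j] := fun i j => by
    funext k; fin_cases k <;> rfl
  refine hΘ ![x, y, y', z] (fun _ => ?_) fun θ hθm => ?_
  · simp only [γ, Formula.realize_inf, hM.realize_lt, Formula.realize_not,
      Formula.realize_relabel, not_lt, hcomp]
    exact ⟨hyx, hxz, hψ, hn⟩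
  · rw [hcomp, hcomp]
    exact hθ _ (Finset.mem_image_of_mem (fun θ => θ.2) hθm)

/-- Finitely many formulas witness that initial parts definable over a tuple are definable over
one of its entries. -/
theorem exists_formulas_lowerSet (hlinear : IsTheoryOfLinearOrders lt T) (hSLB : SLB lt T)
    (hM : InterpretsLT lt M) {n : ℕ} (hn : n ≠ 0) (φ : L.Formula (Fin n ⊕ Fin 1)) :
    ∃ Θ : Finset (L.Formula (Fin 2)), ∀ a : Fin n → M,
      IsLowerSet {x | φ.Realize (Sum.elim a fun _ => x)} →
      ∃ i, ∀ x x' : M, (∀ θ ∈ Θ, θ.Realize ![a i, x] ↔ θ.Realize ![a i, x']) →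
        φ.Realize (Sum.elim a fun _ => x) → φ.Realize (Sum.elim a fun _ => x') := by
  classical
  let lower : L.Formula (Fin n) := Formula.iAlls (Fin 2)
    ((φ.relabel (Sum.map id fun _ => 0)).imp
      ((lt.formula₂ (Term.var (Sum.inr 1)) (Term.var (Sum.inr 0))).imp
        (φ.relabel (Sum.map id fun _ => 1))))
  -- `none` says that the set is an initial part. `some i` puts one point inside and one outside; if
  -- the two are conjugate over `a i` for every `i`, no single entry has a stabilizer preserving the
  -- set.
  let γ : Option (Fin n) → L.Formula (Fin n ⊕ (Fin n ⊕ Fin n)) := fun o => o.elim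
    (lower.relabel Sum.inl) fun i => (φ.relabel (Sum.map id fun _ => Sum.inl i)) ⊓
      (φ.relabel (Sum.map id fun _ => Sum.inr i)).not
  obtain ⟨Θ, hΘ⟩ := exists_finset_formulas_of_automorphisms (M := M) (ι := Fin n) γ
    (J := fun _ => Fin 2) (fun i => ![Sum.inl i, Sum.inr (Sum.inl i)])
    (fun i => ![Sum.inl i, Sum.inr (Sum.inr i)]) (by
      intro N _ _ hMN z hz σ hσ
      have := hMN.theory_model (T := T)
      obtain ⟨_, hN⟩ := hlinear.exists_linearOrder N
      let I : Set N := {x | φ.Realize (Sum.elim (z ∘ Sum.inl) fun _ => x)}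
      have hI : IsLowerSet I := by
        intro x y hyx hx
        rcases hyx.eq_or_lt with rfl | hyx
        · exact hx
        · have h := hz none
          simp only [γ, lower, Option.elim_none, Formula.realize_relabel, Formula.realize_iAlls,
            Formula.realize_imp, hN.realize_lt, comp_sumMap_const] at h
          exact h ![x, y] hx hyx
      have : Nonempty (Fin n) := ⟨⟨0, Nat.pos_of_ne_zero hn⟩⟩
      obtain ⟨a, ha, hfix⟩ := (hSLB.isGlueClosed hN).preserves_of_finset hI
        (A := Finset.univ.image fun i => z (Sum.inl i)) (Finset.univ_nonempty.image _) (by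
          intro k hk hka x
          have h := realize_iff_of_mem_autGroup hk φ (Sum.elim (z ∘ Sum.inl) fun _ => x)
          rw [show (fun i => k ((Sum.elim (z ∘ Sum.inl) fun _ => x : Fin n ⊕ Fin 1 → N) i)) =
            Sum.elim (z ∘ Sum.inl) fun _ => k x by
              funext i
              cases i with
              | inl i => exact hka _ (Finset.mem_image_of_mem _ (Finset.mem_univ i))
              | inr i => rfl] at h
          exact h)
      obtain ⟨i, -, rfl⟩ := Finset.mem_image.1 ha
      obtain ⟨f, hf, hfσ⟩ := hN.exists_mem_autGroup (σ i)
      have hf0 : f (z (Sum.inl i)) = z (Sum.inl i) := (hfσ _).trans (hσ i 0)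
      have hf1 : f (z (Sum.inr (Sum.inl i))) = z (Sum.inr (Sum.inr i)) := (hfσ _).trans (hσ i 1)
      have h := hfix f hf hf0 (z (Sum.inr (Sum.inl i)))
      have h' := hz (some i)
      simp only [γ, Option.elim_some, Formula.realize_inf, Formula.realize_not,
        Formula.realize_relabel, comp_sumMap_const] at h'
      rw [hf1] at h
      exact h'.2 (h.2 h'.1))
  refine ⟨Θ.image fun θ => θ.2, fun a hlow => ?_⟩
  by_contra! hcon
  choose x x' hθ hx hx' using hcon
  have hcomp : ∀ (z : Fin n ⊕ (Fin n ⊕ Fin n) → M) i j, (z ∘ ![i, j] : Fin 2 → M) =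
      ![z i, z j] := fun z i j => by
    funext k; fin_cases k <;> rfl
  refine hΘ (Sum.elim a (Sum.elim x x')) (fun o => ?_) fun θ hθm => ?_
  · cases o with
    | none =>
      simp only [γ, lower, Option.elim_none, Formula.realize_relabel, Formula.realize_iAlls,
        Formula.realize_imp, hM.realize_lt, comp_sumMap_const]
      exact fun y hy hlt => hlow (le_of_lt hlt) hy
    | some i =>
      simp only [γ, Option.elim_some, Formula.realize_inf, Formula.realize_not,
        Formula.realize_relabel, comp_sumMap_const]
      exact ⟨hx i, hx' i⟩
  · rw [hcomp, hcomp]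
    exact hθ θ.1 _ (Finset.mem_image_of_mem (fun θ => θ.2) hθm)

end Models

/-! ### Definable predicates -/

section Definability

variable {L : FirstOrder.Language.{u, v}} {M : Type w} [L.Structure M] {A : Set M} {α β : Type}

/-- A predicate of assignments is definable with parameters from `A`. -/
def DefinablePred (L : FirstOrder.Language.{u, v}) {M : Type w} [L.Structure M] (A : Set M)
    {α : Type} (R : (α → M) → Prop) : Prop :=
  A.Definable L {x | R x}

namespace DefinablePred

variable {R S : (α → M) → Prop}

theorem and (hR : DefinablePred L A R) (hS : DefinablePred L A S) :
    DefinablePred L A fun x => R x ∧ S x := Set.Definable.inter hR hS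

theorem or (hR : DefinablePred L A R) (hS : DefinablePred L A S) :
    DefinablePred L A fun x => R x ∨ S x := Set.Definable.union hR hS

theorem not (hR : DefinablePred L A R) : DefinablePred L A fun x => ¬R x := Set.Definable.compl hR

theorem congr (hR : DefinablePred L A R) (h : ∀ x, R x ↔ S x) : DefinablePred L A S := by
  have : S = R := by
    funext x
    exact propext (h x).symm
  rwa [this]

theorem imp (hR : DefinablePred L A R) (hS : DefinablePred L A S) :
    DefinablePred L A fun x => R x → S x :=
  (hR.not.or hS).congr fun _ => imp_iff_not_or.symm

theorem reindex (hR : DefinablePred L A R) (f : α → β) :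
    DefinablePred L A fun x : β → M => R (fun i => x (f i)) := Set.Definable.preimage_comp f hR

/-- The bound variable is coordinate 0 and the free ones shift up by one; the indices in later
definability proofs follow this convention. -/
theorem exists_ {n : ℕ} {R : M → (Fin n → M) → Prop}
    (hR : DefinablePred L A fun x : Fin (n + 1) → M => R (x 0) fun i => x i.succ) :
    DefinablePred L A fun x => ∃ y, R y x := by
  have h1 := hR.reindex (β := Fin n ⊕ Fin 1) (Fin.cons (Sum.inr 0) Sum.inl)
  refine (show DefinablePred L A _ from Set.Definable.exists_of_finite h1).congr fun x => ?_
  constructor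
  · rintro ⟨y, hy⟩
    exact ⟨y 0, hy⟩
  · rintro ⟨y, hy⟩
    exact ⟨fun _ => y, hy⟩

theorem forall_ {n : ℕ} {R : M → (Fin n → M) → Prop}
    (hR : DefinablePred L A fun x : Fin (n + 1) → M => R (x 0) fun i => x i.succ) :
    DefinablePred L A fun x => ∀ y, R y x :=
  (exists_ (R := fun y x => ¬R y x) hR.not).not.congr fun _ => by
    simp only [not_exists, not_not]

theorem mono {B : Set M} (hR : DefinablePred L A R) (h : A ⊆ B) : DefinablePred L B R :=
  Set.Definable.mono hR h

/-- A binary relation, definable as a predicate of pairs, may be applied to any two variables. -/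
theorem at₂ {B : M → M → Prop} (hB : DefinablePred L A fun x : Fin 2 → M => B (x 0) (x 1))
    (i j : α) : DefinablePred L A fun x : α → M => B (x i) (x j) := hB.reindex ![i, j]

/-- A unary relation, definable as a predicate, may be applied to any variable. -/
theorem at₁ {B : M → Prop} (hB : DefinablePred L A fun x : Fin 1 → M => B (x 0))
    (i : α) : DefinablePred L A fun x : α → M => B (x i) := hB.reindex fun _ => i

theorem equal (i j : α) : DefinablePred L A fun x : α → M => x i = x j :=
  at₂ (B := fun a b => a = b) (Set.Definable.diagonal L A) i j

end DefinablePred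

/-- A set whose members are told apart from its non-members by finitely many definable sets is
definable. -/
theorem definable₁_of_separated {ι : Type*} [Finite ι] {S : ι → Set M}
    (hS : ∀ i, A.Definable₁ L (S i)) {I : Set M}
    (hI : ∀ x x', (∀ i, x ∈ S i ↔ x' ∈ S i) → x ∈ I → x' ∈ I) : A.Definable₁ L I := by
  let c : M → ι → Prop := fun x i => x ∈ S i
  have h1 : ∀ d : ι → Prop, A.Definable L {x : Fin 1 → M | ∀ i, x 0 ∈ S i ↔ d i} := fun d => by
    have : {x : Fin 1 → M | ∀ i, x 0 ∈ S i ↔ d i} = ⋂ i, {x : Fin 1 → M | x 0 ∈ S i ↔ d i} := by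
      ext x; simp
    rw [this]
    refine Set.definable_iInter_of_finite fun i => ?_
    by_cases hd : d i
    · simp only [hd, iff_true]
      exact hS i
    · simp only [hd, iff_false]
      exact (hS i).compl
  have h2 : {x : Fin 1 → M | x 0 ∈ I} =
      ⋃ d : {d : ι → Prop // ∃ x ∈ I, c x = d}, {x : Fin 1 → M | ∀ i, x 0 ∈ S i ↔ d.1 i} := by
    ext x
    simp only [Set.mem_iUnion, Set.mem_ofPred_eq]
    constructor
    · intro hx
      exact ⟨⟨c (x 0), x 0, hx, rfl⟩, fun i => Iff.rfl⟩
    · rintro ⟨⟨_, y, hy, rfl⟩, h⟩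
      exact hI y (x 0) (fun i => (h i).symm) hy
  rw [Set.Definable₁, h2]
  exact Set.definable_iUnion_of_finite fun d => h1 d.1

end Definability

/-! ### The convex equivalence relations attached to a family of initial parts -/

section Families

variable {α : Type w} [LinearOrder α]

/-- There is a strictly increasing chain of `k` further sets `B y` above `B w`, all with
`y ≤ x ∈ B y`. -/
def HasChainAbove (B : α → α → Prop) : ℕ → α → α → Prop
  | 0, x, w => w ≤ x ∧ B w x
  | k + 1, x, w => (w ≤ x ∧ B w x) ∧
      ∃ y, HasChainAbove B k x y ∧ (∀ z, B w z → B y z) ∧ ∃ z, B y z ∧ ¬B w z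

namespace HasChainAbove

variable {B : α → α → Prop} {k : ℕ} {x y w w' : α}

theorem base (h : HasChainAbove B k x w) : w ≤ x ∧ B w x := by
  cases k with
  | zero => exact h
  | succ k => exact h.1

/-- Membership of the new point passes up the chain by inclusion. Thus ranks can only grow as the
point moves right within `B w`. -/
theorem mono (h : HasChainAbove B k x w) (hxy : x ≤ y) (hw : B w y) : HasChainAbove B k y w := by
  induction k generalizing w with
  | zero => exact ⟨h.1.trans hxy, hw⟩
  | succ k ih =>
    obtain ⟨h0, v, hv, hwv, hne⟩ := h
    exact ⟨⟨h0.1.trans hxy, hw⟩, v, ih hv (hwv y hw), hwv, hne⟩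

theorem congr (h : HasChainAbove B k x w) (hw : w' ≤ x) (hB : ∀ z, B w z ↔ B w' z) :
    HasChainAbove B k x w' := by
  cases k with
  | zero => exact ⟨hw, (hB x).1 h.2⟩
  | succ k =>
    obtain ⟨h0, v, hv, hwv, z, hz, hz'⟩ := h
    exact ⟨⟨hw, (hB x).1 h0.2⟩, v, hv, fun z hz => hwv z ((hB z).2 hz), z, hz,
      fun h => hz' ((hB z).2 h)⟩

/-- If sets of the same colour coincide, then the sets in a chain have different colours. -/
theorem exists_finset (h : HasChainAbove B k x w) {κ : Type*} (c : α → κ)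
    (hc : ∀ w w', w ≤ x → w' ≤ x → B w x → B w' x → c w = c w' → ∀ z, B w z → B w' z) :
    ∃ F : Finset κ, F.card = k + 1 ∧
      ∀ d ∈ F, ∃ y ≤ x, B y x ∧ c y = d ∧ ∀ z, B w z → B y z := by
  classical
  induction k generalizing w with
  | zero => exact ⟨{c w}, rfl, fun d hd => ⟨w, h.1, h.2, (Finset.mem_singleton.1 hd).symm,
      fun z hz => hz⟩⟩
  | succ k ih =>
    obtain ⟨h0, v, hv, hwv, z, hz, hz'⟩ := h
    obtain ⟨F, hF, hFd⟩ := ih hv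
    have hwF : c w ∉ F := fun hmem => by
      obtain ⟨y, hyx, hy, hcy, hvy⟩ := hFd _ hmem
      exact hz' (hc y w hyx h0.1 hy h0.2 hcy z (hvy z hz))
    refine ⟨insert (c w) F, by rw [Finset.card_insert_of_notMem hwF, hF], fun d hd => ?_⟩
    rcases Finset.mem_insert.1 hd with rfl | hd
    · exact ⟨w, h0.1, h0.2, rfl, fun z hz => hz⟩
    · obtain ⟨y, hyx, hy, hcy, hvy⟩ := hFd d hd
      exact ⟨y, hyx, hy, hcy, fun z hz => hvy z (hwv z hz)⟩

end HasChainAbove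

/-- `B w` has exactly `k` sets of the family strictly above it among the `B y` with
`y ≤ x ∈ B y`. -/
def HasRank (B : α → α → Prop) (k : ℕ) (x w : α) : Prop :=
  HasChainAbove B k x w ∧ ¬HasChainAbove B (k + 1) x w

variable {B : α → α → Prop} {k : ℕ}

/-- Initial parts are nested, and a proper inclusion would lengthen the chain above the smaller set
by one. -/
theorem HasRank.iff (hlow : ∀ w, IsLowerSet {x | B w x}) {x w w' : α} (h : HasRank B k x w)
    (h' : HasRank B k x w') (z : α) : B w z ↔ B w' z := by
  have key : ∀ {w w'}, HasRank B k x w → HasRank B k x w' → {x | B w x} ⊆ {x | B w' x} →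
      ∀ z, B w z ↔ B w' z := by
    intro w w' h h' hsub z
    refine ⟨fun hz => hsub hz, fun hz => ?_⟩
    by_contra hz'
    exact h.2 ⟨h.1.base, w', h'.1, fun z hz => hsub hz, z, hz, hz'⟩
  rcases (hlow w).total (hlow w') with hsub | hsub
  · exact key h h' hsub z
  · exact (key h' h hsub z).symm

/-- Ranks grow with the point, so equal ranks at `x` and `z` force the same rank between them. This
makes the classes of `rankSetoid` convex. -/
theorem HasRank.of_between {x y z w w' : α} (hx : HasRank B k x w) (hz : HasRank B k z w')
    (hxy : x ≤ y) (hyz : y ≤ z) (hw : B w y) (hww' : ∀ t, B w t ↔ B w' t) : HasRank B k y w :=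
  ⟨hx.1.mono hxy hw, fun h => hz.2 ((h.mono hyz ((hww' z).2 hz.1.base.2)).congr hz.1.base.1 hww')⟩

/-- Two points are equivalent if the sets of rank `k` at them coincide. -/
def rankSetoid (B : α → α → Prop) (hlow : ∀ w, IsLowerSet {x | B w x}) (k : ℕ) : Setoid α where
  -- The clause `x = y` gives reflexivity at points where no set has rank `k`.
  r x y := x = y ∨ ∃ w w', HasRank B k x w ∧ HasRank B k y w' ∧ ∀ z, B w z ↔ B w' z
  iseqv := by
    refine ⟨fun x => Or.inl rfl, ?_, ?_⟩
    · rintro x y (rfl | ⟨w, w', h, h', e⟩)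
      · exact Or.inl rfl
      · exact Or.inr ⟨w', w, h', h, fun z => (e z).symm⟩
    · rintro x y z (rfl | ⟨w, w', h, h', e⟩)
      · exact fun h => h
      · rintro (rfl | ⟨v, v', g, g', f⟩)
        · exact Or.inr ⟨w, w', h, h', e⟩
        · exact Or.inr ⟨w, v', h, g', fun z => (e z).trans ((h'.iff hlow g z).trans (f z))⟩

theorem rankSetoid_ordConnected (hlow : ∀ w, IsLowerSet {x | B w x}) (a : α) :
    {x | rankSetoid B hlow k x a}.OrdConnected := by
  refine ⟨fun x hx z hz y hy => ?_⟩
  have hxz : rankSetoid B hlow k x z := (rankSetoid B hlow k).trans hx ((rankSetoid B hlow k).symm hz)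
  suffices h : rankSetoid B hlow k y x from (rankSetoid B hlow k).trans h hx
  rcases hxz with rfl | ⟨w, w', h, h', e⟩
  · exact Or.inl (le_antisymm hy.2 hy.1)
  · refine Or.inr ⟨w, w, h.of_between h' hy.1 hy.2 ?_ e, h, fun _ => Iff.rfl⟩
    exact hlow w hy.2 ((e z).2 h'.1.base.2)

section

variable {L : FirstOrder.Language.{u, v}} [L.Structure α]

theorem definablePred_hasChainAbove (hlt : DefinablePred L (∅ : Set α) fun x : Fin 2 → α => x 0 < x 1)
    (hB : DefinablePred L (∅ : Set α) fun x : Fin 2 → α => B (x 0) (x 1)) (k : ℕ) :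
    DefinablePred L (∅ : Set α) fun x : Fin 2 → α => HasChainAbove B k (x 0) (x 1) := by
  have hbase : DefinablePred L (∅ : Set α) fun x : Fin 2 → α => x 1 ≤ x 0 ∧ B (x 1) (x 0) :=
    (hlt.not.congr fun _ => not_lt).and (hB.at₂ 1 0)
  induction k with
  | zero => exact hbase
  | succ k ih =>
    refine hbase.and (DefinablePred.exists_ ((ih.at₂ 1 0).and (.and ?_ ?_)))
    · exact DefinablePred.forall_ ((hB.at₂ 3 0).imp (hB.at₂ 1 0))
    · exact DefinablePred.exists_ ((hB.at₂ 1 0).and (hB.at₂ 3 0).not)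

theorem isDefinableConvexEquiv_rankSetoid
    (hlt : DefinablePred L (∅ : Set α) fun x : Fin 2 → α => x 0 < x 1)
    (hB : DefinablePred L (∅ : Set α) fun x : Fin 2 → α => B (x 0) (x 1))
    (hlow : ∀ w, IsLowerSet {x | B w x}) : IsDefinableConvexEquiv L (rankSetoid B hlow k) := by
  refine ⟨?_, rankSetoid_ordConnected hlow⟩
  have hrank : DefinablePred L (∅ : Set α) fun x : Fin 2 → α => HasRank B k (x 0) (x 1) :=
    (definablePred_hasChainAbove hlt hB k).and (definablePred_hasChainAbove hlt hB (k + 1)).not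
  exact (DefinablePred.equal 0 1).or (DefinablePred.exists_ (DefinablePred.exists_
    ((hrank.at₂ 2 1).and ((hrank.at₂ 3 0).and (DefinablePred.forall_
      (((hB.at₂ 2 0).imp (hB.at₂ 1 0)).and ((hB.at₂ 1 0).imp (hB.at₂ 2 0))
        |>.congr fun _ => iff_iff_implies_and_implies.symm))))))

/-- A member of a definable family of initial parts, finitely many of which are relevant at each
point, ends with a class of a definable convex equivalence relation. -/
theorem exists_isDefinableConvexEquiv_of_family
    (hlt : DefinablePred L (∅ : Set α) fun x : Fin 2 → α => x 0 < x 1)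
    (hB : DefinablePred L (∅ : Set α) fun x : Fin 2 → α => B (x 0) (x 1))
    (hlow : ∀ w, IsLowerSet {x | B w x}) {κ : Type*} [Finite κ] (c : α → α → κ)
    (hc : ∀ x w w', w ≤ x → w' ≤ x → B w x → B w' x → c x w = c x w' → ∀ z, B w z → B w' z)
    {a : α} (ha : B a a) :
    ∃ E : Setoid α, IsDefinableConvexEquiv L E ∧ ∃ x₀, {x | B a x} = Set.Iio x₀ ∪ {x | E x x₀} := by
  classical
  have := Fintype.ofFinite κ
  have hbound : ∀ k x, HasChainAbove B k x a → k ≤ Fintype.card κ := fun k x h => by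
    obtain ⟨F, hF, -⟩ := h.exists_finset (c x) (hc x)
    have := F.card_le_univ
    lia
  -- The rank of `B a` is bounded by the number of colours and grows with the point, so it is
  -- constantly equal to its maximum `k` on `B a` from some `x₀` on.
  let k := Nat.findGreatest (fun k => ∃ x, HasChainAbove B k x a) (Fintype.card κ)
  obtain ⟨x₀, hx₀⟩ : ∃ x, HasChainAbove B k x a :=
    Nat.findGreatest_spec (P := fun k => ∃ x, HasChainAbove B k x a) (Nat.zero_le _)
      ⟨a, le_rfl, ha⟩
  have hrank : ∀ x, x₀ ≤ x → B a x → HasRank B k x a := fun x hx hax =>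
    ⟨hx₀.mono hx hax, fun h => by
      have := Nat.le_findGreatest (P := fun k => ∃ x, HasChainAbove B k x a) (hbound _ _ h) ⟨x, h⟩
      exact (Nat.lt_succ_self k).not_ge this⟩
  refine ⟨rankSetoid B hlow k, isDefinableConvexEquiv_rankSetoid hlt hB hlow, x₀, ?_⟩
  have ha₀ : B a x₀ := hx₀.base.2
  ext x
  constructor
  · intro hx
    rcases lt_or_ge x x₀ with h | h
    · exact Or.inl h
    · exact Or.inr (Or.inr ⟨a, a, hrank x h hx, hrank x₀ le_rfl ha₀, fun _ => Iff.rfl⟩)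
  · rintro (h | rfl | ⟨w, w', h, h', e⟩)
    · exact hlow a (le_of_lt h) ha₀
    · exact ha₀
    · exact (h'.iff hlow (hrank x₀ le_rfl ha₀) x).1 ((e x).1 h.1.base.2)

end

end Families

section Families

variable {L : FirstOrder.Language.{u, v}} {α : Type w} [LinearOrder α] [L.Structure α]

/-- The order dual of `exists_isDefinableConvexEquiv_of_family`. -/
theorem exists_isDefinableConvexEquiv_of_upper_family {B : α → α → Prop}
    (hlt : DefinablePred L (∅ : Set α) fun x : Fin 2 → α => x 0 < x 1)
    (hB : DefinablePred L (∅ : Set α) fun x : Fin 2 → α => B (x 0) (x 1))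
    (hupp : ∀ w, IsUpperSet {x | B w x}) {κ : Type*} [Finite κ] (c : α → α → κ)
    (hc : ∀ x w w', x ≤ w → x ≤ w' → B w x → B w' x → c x w = c x w' → ∀ z, B w z → B w' z)
    {a : α} (ha : B a a) :
    ∃ E : Setoid α, IsDefinableConvexEquiv L E ∧ ∃ x₀, {x | B a x} = Set.Ioi x₀ ∪ {x | E x x₀} := by
  let _ : L.Structure αᵒᵈ := inferInstanceAs (L.Structure α)
  obtain ⟨E, ⟨hE, hE'⟩, x₀, h⟩ := exists_isDefinableConvexEquiv_of_family (α := αᵒᵈ) (L := L)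
    (B := B) (hlt.at₂ (B := fun a b : α => a < b) 1 0) hB (fun w x y hyx hx => hupp w hyx hx) c
    (fun x w w' h h' => hc x w w' h h') (a := a) ha
  exact ⟨E, ⟨hE, fun a => (hE' a).dual⟩, x₀, h⟩

end Families

section Models

variable {L : FirstOrder.Language.{u, v}} {lt : L.Relations 2} {T : L.Theory}

theorem InterpretsLT.definablePred_lt {M : Type w} [L.Structure M] [LinearOrder M]
    (hM : InterpretsLT lt M) (A : Set M) :
    DefinablePred L A fun x : Fin 2 → M => x 0 < x 1 := by
  refine DefinablePred.mono (A := ∅) ?_ (Set.empty_subset A)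
  refine Set.empty_definable_iff.2 ⟨lt.formula₂ (Term.var 0) (Term.var 1), ?_⟩
  ext x
  exact (hM.realize_lt 0 1 x).symm

/-! ### Definable initial parts -/

/-- The sets generating the Boolean algebra of the main theorem. -/
def basicSets (L : FirstOrder.Language.{u, v}) (M : Type w) [L.Structure M] [LinearOrder M] :
    Set (Set M) :=
  {S | IsUnaryDefinable L S ∨ IsRay S ∨ IsDefinableConvexClass L S}

theorem exists_formula_of_definable₁ {M : Type w} [L.Structure M] {A D : Set M}
    (h : A.Definable₁ L D) : ∃ (n : ℕ) (a : Fin n → M) (φ : L.Formula (Fin n ⊕ Fin 1)),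
      D = {x | φ.Realize (Sum.elim a fun _ => x)} := by
  obtain ⟨A₀, -, h⟩ := Set.definable_iff_finitely_definable.1 h
  obtain ⟨φ, hφ⟩ := Set.definable_iff_exists_formula_sum.1 h
  let e := A₀.equivFin
  refine ⟨_, fun i => e.symm i, φ.relabel (Sum.map e id), ?_⟩
  ext x
  have := Set.ext_iff.1 hφ fun _ => x
  rw [Set.mem_ofPred_eq, Formula.realize_relabel]
  refine this.trans ?_
  rw [Set.mem_ofPred_eq]
  refine iff_of_eq (congrArg _ ?_)
  funext i
  cases i with
  | inl i => exact congrArg Subtype.val (e.symm_apply_apply i).symm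
  | inr i => rfl

variable {M : Type w} [L.Structure M]

theorem definable₁_singleton_of_formula (θ : L.Formula (Fin 2)) (d : M) :
    ({d} : Set M).Definable₁ L {x | θ.Realize ![d, x]} := by
  refine Set.definable_iff_exists_formula_sum.2
    ⟨θ.relabel ![Sum.inl ⟨d, rfl⟩, Sum.inr 0], ?_⟩
  ext x
  rw [Set.mem_ofPred_eq, Set.mem_ofPred_eq, Set.mem_ofPred_eq, Formula.realize_relabel]
  refine iff_of_eq (congrArg _ ?_)
  funext i
  fin_cases i <;> rfl

theorem exists_formula_of_definable₁_singleton {d : M} {I : Set M}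
    (h : ({d} : Set M).Definable₁ L I) :
    ∃ ψ : L.Formula (Fin 2), I = {x | ψ.Realize ![d, x]} := by
  obtain ⟨φ, hφ⟩ := Set.definable_iff_exists_formula_sum.1 h
  refine ⟨φ.relabel (Sum.elim (fun _ => 0) fun _ => 1), ?_⟩
  ext x
  have := Set.ext_iff.1 hφ fun _ => x
  rw [Set.mem_ofPred_eq, Formula.realize_relabel]
  refine this.trans ?_
  rw [Set.mem_ofPred_eq]
  refine iff_of_eq (congrArg _ ?_)
  funext i
  rcases i with ⟨i, rfl⟩ | i
  · rfl
  · rfl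

theorem definablePred_formula₂ (ψ : L.Formula (Fin 2)) :
    DefinablePred L (∅ : Set M) fun x : Fin 2 → M => ψ.Realize ![x 0, x 1] := by
  refine Set.empty_definable_iff.2 ⟨ψ, ?_⟩
  ext x
  change ψ.Realize ![x 0, x 1] ↔ ψ.Realize x
  refine iff_of_eq (congrArg _ ?_)
  funext i
  fin_cases i <;> rfl

variable [LinearOrder M] [Nonempty M] [T.Model M]

/-- Every parametrically definable initial part is definable from one parameter. -/
theorem exists_definable_singleton_of_lowerSet (hlinear : IsTheoryOfLinearOrders lt T)
    (hSLB : SLB lt T) (hM : InterpretsLT lt M) {A I : Set M} (hI : IsLowerSet I)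
    (hA : A.Definable₁ L I) : ∃ d : M, ({d} : Set M).Definable₁ L I := by
  obtain ⟨n, a, φ, rfl⟩ := exists_formula_of_definable₁ hA
  obtain ⟨m⟩ := ‹Nonempty M›
  have : Nonempty M := ⟨m⟩
  -- A dummy parameter is added, since `exists_formulas_lowerSet` needs at least one.
  let φ' : L.Formula (Fin (n + 1) ⊕ Fin 1) := φ.relabel (Sum.map Fin.succ id)
  let a' : Fin (n + 1) → M := Fin.cons m a
  have hφ' : ∀ x, φ'.Realize (Sum.elim a' fun _ => x) ↔ φ.Realize (Sum.elim a fun _ => x) := by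
    intro x
    rw [Formula.realize_relabel]
    refine iff_of_eq (congrArg _ ?_)
    funext i
    cases i <;> rfl
  simp only [← hφ'] at hI ⊢
  obtain ⟨Θ, hΘ⟩ := exists_formulas_lowerSet hlinear hSLB hM n.succ_ne_zero φ'
  obtain ⟨i, hi⟩ := hΘ a' hI
  exact ⟨a' i, definable₁_of_separated (ι := Θ)
    (fun θ => definable₁_singleton_of_formula θ.1 (a' i))
    fun x x' h hx => hi x x' (fun θ hθ => h ⟨θ, hθ⟩) hx⟩

/-- With `I` defined by `ψ` over one point `d`, varying `d` embeds `I` or its complement in a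
definable family. Independence over a point `x` makes the `Θ`-type of `w` over `x` a colouring with
finitely many values, as `exists_isDefinableConvexEquiv_of_family` or its dual requires. -/
theorem lowerSet_mem_closure_basicSets (hlinear : IsTheoryOfLinearOrders lt T)
    (hSLB : SLB lt T) (hM : InterpretsLT lt M) {A I : Set M} (hI : IsLowerSet I)
    (hA : A.Definable₁ L I) : I ∈ BooleanSubalgebra.closure (basicSets L M) := by
  obtain ⟨d, hd⟩ := exists_definable_singleton_of_lowerSet hlinear hSLB hM hI hA
  obtain ⟨ψ, rfl⟩ := exists_formula_of_definable₁_singleton hd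
  have hlt := hM.definablePred_lt (∅ : Set M)
  have hle : DefinablePred L (∅ : Set M) fun x : Fin 2 → M => x 0 ≤ x 1 :=
    (hlt.at₂ (B := fun a b : M => a < b) 1 0).not.congr fun _ => not_lt
  have hψ : DefinablePred L (∅ : Set M) fun x : Fin 2 → M => ψ.Realize ![x 0, x 1] :=
    definablePred_formula₂ ψ
  have hmem : ∀ S ∈ basicSets L M, S ∈ BooleanSubalgebra.closure (basicSets L M) :=
    fun S hS => BooleanSubalgebra.subset_closure hS
  by_cases hdI : ψ.Realize ![d, d]
  -- For other parameters `ψ` need not define an initial part. Closing downwards and adding `w`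
  -- repairs this and changes nothing at `d`, as `d ∈ I`.
  · let B : M → M → Prop := fun w x => x ≤ w ∨ ∃ z, ψ.Realize ![w, z] ∧ x ≤ z
    obtain ⟨Θ, hΘ⟩ := exists_formulas_below hlinear hSLB hM ψ
    obtain ⟨E, hE, x₀, h⟩ := exists_isDefinableConvexEquiv_of_family (L := L) (B := B) hlt
      ((hle.at₂ (B := fun a b : M => a ≤ b) 1 0).or (DefinablePred.exists_
        ((hψ.at₂ (B := fun a b : M => ψ.Realize ![a, b]) 1 0).and
          (hle.at₂ (B := fun a b : M => a ≤ b) 2 0))))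
      (fun w x y hyx hx => hx.imp hyx.trans fun ⟨z, hz, hxz⟩ => ⟨z, hz, hyx.trans hxz⟩)
      (fun x w => fun θ : Θ => θ.1.Realize ![x, w])
      (fun x w w' hw hw' hBw hBw' hc z hz => by
        rcases le_or_gt z x with hzx | hxz
        · exact hBw'.imp hzx.trans fun ⟨t, ht, hxt⟩ => ⟨t, ht, hzx.trans hxt⟩
        · rcases hz with hz | ⟨t, ht, hzt⟩
          · exact absurd (hz.trans hw) hxz.not_ge
          · exact Or.inr ⟨t, hΘ x w w' t hw hw' (hxz.trans_le hzt)
              (fun θ hθ => iff_of_eq (congrFun hc ⟨θ, hθ⟩)) ht, hzt⟩)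
      (a := d) (Or.inl le_rfl)
    have hBd : {x | B d x} = {x | ψ.Realize ![d, x]} := by
      ext x
      constructor
      · rintro (hx | ⟨z, hz, hxz⟩)
        · exact hI hx hdI
        · exact hI hxz hz
      · exact fun hx => Or.inr ⟨x, hx, le_rfl⟩
    rw [← hBd, h]
    exact BooleanSubalgebra.sup_mem (hmem _ (Or.inr (Or.inl ⟨x₀, Or.inr rfl⟩)))
      (hmem _ (Or.inr (Or.inr ⟨E, hE, x₀, rfl⟩)))
  · let B : M → M → Prop := fun w x => w ≤ x ∨ ∃ z, ¬ψ.Realize ![w, z] ∧ z ≤ x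
    obtain ⟨Θ, hΘ⟩ := exists_formulas_above hlinear hSLB hM ψ.not
    obtain ⟨E, hE, x₀, h⟩ := exists_isDefinableConvexEquiv_of_upper_family (L := L) (B := B) hlt
      ((hle.at₂ (B := fun a b : M => a ≤ b) 0 1).or (DefinablePred.exists_
        ((hψ.at₂ (B := fun a b : M => ψ.Realize ![a, b]) 1 0).not.and
          (hle.at₂ (B := fun a b : M => a ≤ b) 0 2))))
      (fun w x y hxy hx => hx.imp (fun h => h.trans hxy) fun ⟨z, hz, hzx⟩ => ⟨z, hz, hzx.trans hxy⟩)
      (fun x w => fun θ : Θ => θ.1.Realize ![x, w])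
      (fun x w w' hw hw' hBw hBw' hc z hz => by
        rcases le_or_gt x z with hxz | hzx
        · exact hBw'.imp (fun h => h.trans hxz) fun ⟨t, ht, htx⟩ => ⟨t, ht, htx.trans hxz⟩
        · rcases hz with hz | ⟨t, ht, htz⟩
          · exact absurd (hw.trans hz) hzx.not_ge
          · exact Or.inr ⟨t, hΘ x w w' t hw hw' (htz.trans_lt hzx)
              (fun θ hθ => iff_of_eq (congrFun hc ⟨θ, hθ⟩)) ht, htz⟩)
      (a := d) (Or.inl le_rfl)
    have hBd : {x | B d x} = {x | ψ.Realize ![d, x]}ᶜ := by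
      ext x
      constructor
      · rintro (hx | ⟨z, hz, hzx⟩)
        · exact fun h => hdI (hI hx h)
        · exact fun h => hz (hI hzx h)
      · exact fun hx => Or.inr ⟨x, hx, le_rfl⟩
    rw [← BooleanSubalgebra.compl_mem_iff, ← hBd, h]
    exact BooleanSubalgebra.sup_mem (hmem _ (Or.inr (Or.inl ⟨x₀, Or.inl rfl⟩)))
      (hmem _ (Or.inr (Or.inr ⟨E, hE, x₀, rfl⟩)))

end Models

/-! ### Convex components -/

section Components

variable {M : Type w} [LinearOrder M] {P D : Set M}

/-- The union of the convex components of `D ∩ P` in `P` having at least `j` components before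
them. -/
def afterComponents (P D : Set M) : ℕ → Set M
  | 0 => D ∩ P
  | j + 1 => {y | y ∈ afterComponents P D j ∧
      ∃ y', y' ∈ afterComponents P D j ∧ ∃ z, z ∈ P ∧ y' < z ∧ z < y ∧ z ∉ D}

theorem afterComponents_succ_subset (j : ℕ) :
    afterComponents P D (j + 1) ⊆ afterComponents P D j := fun _ h => h.1

theorem afterComponents_antitone : Antitone (afterComponents P D) :=
  antitone_nat_of_succ_le afterComponents_succ_subset

theorem afterComponents_subset (j : ℕ) : afterComponents P D j ⊆ D ∩ P :=
  afterComponents_antitone (Nat.zero_le j)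

theorem afterComponents_of_le {j : ℕ} {x z : M} (hx : x ∈ afterComponents P D j)
    (hz : z ∈ D ∩ P) (hxz : x ≤ z) : z ∈ afterComponents P D j := by
  induction j generalizing x z with
  | zero => exact hz
  | succ j ih =>
    obtain ⟨hxj, y', hy', t, ht, hyt, htx, htD⟩ := hx
    exact ⟨ih hxj hz hxz, y', hy', t, ht, hyt, htx.trans_le hxz, htD⟩

/-- Points of `D ∩ P` separated by a point of `P` outside `D` have different colours, so the number
of components is at most the number of colours. -/
theorem exists_finset_of_mem_afterComponents {κ : Type*} (c : M → κ)
    (hc : ∀ x ∈ P, ∀ y ∈ P, ∀ x' ∈ P, x < y → y < x' → c x = c x' → x ∈ D → y ∈ D) {j : ℕ} {y : M}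
    (hy : y ∈ afterComponents P D j) :
    ∃ F : Finset κ, F.card = j + 1 ∧ ∀ d ∈ F, ∃ y' ∈ D ∩ P, y' ≤ y ∧ c y' = d := by
  classical
  induction j generalizing y with
  | zero => exact ⟨{c y}, rfl, fun d hd => ⟨y, hy, le_rfl, (Finset.mem_singleton.1 hd).symm⟩⟩
  | succ j ih =>
    have hyDP := afterComponents_subset _ hy
    obtain ⟨hyj, y', hy', z, hz, hyz, hzy, hzD⟩ := hy
    obtain ⟨F, hF, hFd⟩ := ih hy'
    have hyF : c y ∉ F := fun hmem => by
      obtain ⟨t, ht, hty, hct⟩ := hFd _ hmem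
      exact hzD (hc t ht.2 z hz y hyDP.2 (hty.trans_lt hyz) hzy hct ht.1)
    refine ⟨insert (c y) F, by rw [Finset.card_insert_of_notMem hyF, hF], fun d hd => ?_⟩
    rcases Finset.mem_insert.1 hd with rfl | hd
    · exact ⟨y, hyDP, le_rfl, rfl⟩
    · obtain ⟨t, ht, hty, hct⟩ := hFd d hd
      exact ⟨t, ht, hty.trans (hyz.trans hzy).le, hct⟩

/-- The convex component of `D ∩ P` in `P` with exactly `j` components before it. -/
def nthComponent (P D : Set M) (j : ℕ) : Set M := afterComponents P D j \ afterComponents P D (j + 1)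

theorem nthComponent_subset (j : ℕ) : nthComponent P D j ⊆ D ∩ P := fun _ hx =>
  afterComponents_subset j hx.1

theorem nthComponent_convex {j : ℕ} {x y z : M} (hx : x ∈ nthComponent P D j)
    (hy : y ∈ nthComponent P D j) (hz : z ∈ P) (hxz : x ≤ z) (hzy : z ≤ y) :
    z ∈ nthComponent P D j := by
  have hzD : z ∈ D := by
    rcases hxz.eq_or_lt with rfl | hxz
    · exact (nthComponent_subset j hx).1
    rcases hzy.eq_or_lt with rfl | hzy
    · exact (nthComponent_subset j hy).1
    by_contra hzD
    exact hy.2 ⟨hy.1, x, hx.1, z, hz, hxz, hzy, hzD⟩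
  exact ⟨afterComponents_of_le hx.1 ⟨hzD, hz⟩ hxz,
    fun h => hy.2 (afterComponents_of_le h (nthComponent_subset j hy) hzy)⟩

theorem disjoint_nthComponent {i j : ℕ} (hij : i ≠ j) :
    Disjoint (nthComponent P D i) (nthComponent P D j) := by
  wlog h : i < j generalizing i j
  · exact (this hij.symm (lt_of_le_of_ne (not_lt.1 h) hij.symm)).symm
  · rw [Set.disjoint_left]
    exact fun x hi hj => hi.2 (afterComponents_antitone h hj.1)

theorem exists_mem_nthComponent {m : ℕ} (hm : ∀ x, x ∉ afterComponents P D m) {x : M}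
    (hx : x ∈ D ∩ P) : ∃ j < m, x ∈ nthComponent P D j := by
  induction m with
  | zero => exact absurd hx (hm x)
  | succ m ih =>
    by_cases h : ∀ x, x ∉ afterComponents P D m
    · obtain ⟨j, hj, hxj⟩ := ih h
      exact ⟨j, hj.trans m.lt_succ_self, hxj⟩
    · by_contra! hcon
      have : ∀ j ≤ m + 1, x ∈ afterComponents P D j := by
        intro j hj
        induction j with
        | zero => exact hx
        | succ j ihj =>
          by_contra hxj
          exact hcon j (by lia) ⟨ihj (by lia), hxj⟩
      exact hm x (this _ le_rfl)

theorem definablePred_afterComponents {L : FirstOrder.Language.{u, v}} [L.Structure M] {A : Set M}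
    (hlt : DefinablePred L A fun x : Fin 2 → M => x 0 < x 1) (hP : A.Definable₁ L P)
    (hD : A.Definable₁ L D) (j : ℕ) :
    DefinablePred L A fun x : Fin 1 → M => x 0 ∈ afterComponents P D j := by
  have hP : DefinablePred L A fun x : Fin 1 → M => x 0 ∈ P := hP
  have hD : DefinablePred L A fun x : Fin 1 → M => x 0 ∈ D := hD
  induction j with
  | zero => exact hD.and hP
  | succ j ih =>
    refine ih.and (DefinablePred.exists_ ((ih.at₁ (B := fun a => a ∈ _) 0).and
      (DefinablePred.exists_ ((hP.at₁ (B := fun a => a ∈ P) 0).and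
        ((hlt.at₂ (B := fun a b : M => a < b) 1 0).and
          ((hlt.at₂ (B := fun a b : M => a < b) 0 2).and (hD.at₁ (B := fun a => a ∈ D) 0).not))))))

end Components

/-! ### Partition into definably convex sets and its consequences -/

section Models

variable {L : FirstOrder.Language.{u, v}} {lt : L.Relations 2} {T : L.Theory}

theorem isUnaryDefinable_formula {M : Type w} [L.Structure M] (δ : L.Formula (Fin 1)) :
    IsUnaryDefinable L {x : M | δ.Realize fun _ => x} := by
  refine Set.empty_definable_iff.2 ⟨δ, ?_⟩
  ext x
  change (δ.Realize fun _ => x 0) ↔ δ.Realize x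
  refine iff_of_eq (congrArg _ ?_)
  funext i
  fin_cases i
  rfl

theorem IsUnaryDefinable.mem_of_locus {M : Type w} [L.Structure M] [Nonempty M]
    [T.Model M] {P : Set M} (hP : IsUnaryDefinable L P)
    {q : T.CompleteType (Fin 1)} {x y : M} (hx : x ∈ locus M q) (hy : y ∈ locus M q)
    (hxP : x ∈ P) : y ∈ P := by
  obtain ⟨φ, hφ⟩ := Set.empty_definable_iff.1 hP
  have h : ∀ z : M, z ∈ P ↔ φ.Realize fun _ : Fin 1 => z := fun z => Set.ext_iff.1 hφ fun _ => z
  have hxy : T.typeOf (fun _ : Fin 1 => x) = T.typeOf (fun _ : Fin 1 => y) := hx.trans hy.symm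
  rw [h, ← Theory.CompleteType.formula_mem_typeOf (T := T)] at hxP ⊢
  rwa [← hxy]

variable {M : Type w} [L.Structure M] [LinearOrder M] [Nonempty M] [T.Model M]

/-- Definable sets are finite disjoint unions of definably convex sets definable over the same
parameters. -/
theorem exists_finpartition_definablyConvex (hlinear : IsTheoryOfLinearOrders lt T)
    (hSLB : SLB lt T) (hM : InterpretsLT lt M) {A D : Set M} (hD : A.Definable₁ L D) :
    ∃ Q : Finpartition D, ∀ S ∈ Q.parts, A.Definable₁ L S ∧ IsDefinablyConvex L S := by
  classical
  obtain ⟨n, a, φ, hφ⟩ := exists_formula_of_definable₁ hD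
  obtain ⟨Θ, Δ, hΘΔ⟩ := exists_formulas_convex hlinear hSLB hM φ
  -- The finitely many `Δ`-classes replace complete types over the empty set; within each, the
  -- `Θ`-type over `a` serves as the colour.
  let P : (Δ → Prop) → Set M := fun τ => {x | ∀ δ : Δ, δ.1.Realize (fun _ => x) ↔ τ δ}
  have hP : ∀ τ, IsUnaryDefinable L (P τ) := fun τ =>
    definable₁_of_separated (fun δ : Δ => isUnaryDefinable_formula δ.1)
      fun x x' h hx δ => (h δ).symm.trans (hx δ)
  have hPdisj : ∀ {τ τ' x}, x ∈ P τ → x ∈ P τ' → τ = τ' := fun h h' =>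
    funext fun δ => propext ((h δ).symm.trans (h' δ))
  let c : M → Θ → Prop := fun x θ => θ.1.Realize (Sum.elim a fun _ => x)
  let m := Fintype.card (Θ → Prop)
  have hm : ∀ τ x, x ∉ afterComponents (P τ) D m := fun τ x hx => by
    obtain ⟨F, hF, -⟩ := exists_finset_of_mem_afterComponents c
      (fun x hx y hy x' hx' hxy hyx' hcx hxD => by
        rw [hφ] at hxD ⊢
        exact hΘΔ a x y x' hxy hyx' (fun θ hθ => iff_of_eq (congrFun hcx ⟨θ, hθ⟩))
          (fun δ hδ => (hx ⟨δ, hδ⟩).trans (hy ⟨δ, hδ⟩).symm) hxD) hx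
    have : F.card ≤ m := F.card_le_univ
    lia
  let K : (Δ → Prop) × Fin m → Set M := fun p => nthComponent (P p.1) D p.2
  have hK : ∀ p, A.Definable₁ L (K p) ∧ IsDefinablyConvex L (K p) := fun p => by
    have hlev := definablePred_afterComponents (hM.definablePred_lt A)
      ((hP p.1).mono (Set.empty_subset A)) hD
    exact ⟨(hlev p.2).and (hlev (p.2 + 1)).not, P p.1, hP p.1,
      fun x hx => (nthComponent_subset _ hx).2,
      fun x hx y hy z hz hxz hzy => nthComponent_convex hx hy hz hxz hzy⟩
  have hKdisj : ∀ p q, p ≠ q → Disjoint (K p) (K q) := by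
    rintro ⟨τ, i⟩ ⟨τ', j⟩ hne
    by_cases hτ : τ = τ'
    · subst hτ
      exact disjoint_nthComponent fun hij => hne (congrArg (Prod.mk τ) (Fin.ext hij))
    · rw [Set.disjoint_left]
      exact fun x hx hx' => hτ (hPdisj (nthComponent_subset _ hx).2 (nthComponent_subset _ hx').2)
  have hsup : (Finset.univ.image K).sup id = D := by
    ext x
    simp only [Finset.sup_image, Finset.sup_set_eq_biUnion, Set.mem_iUnion, Finset.mem_univ,
      exists_true_left, Function.comp_apply, id_eq]
    constructor
    · rintro ⟨p, hp⟩
      exact (nthComponent_subset _ hp).1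
    · intro hx
      obtain ⟨j, hj, hxj⟩ := exists_mem_nthComponent (hm fun δ => δ.1.Realize fun _ => x)
        (x := x) ⟨hx, fun δ => Iff.rfl⟩
      exact ⟨⟨_, ⟨j, hj⟩⟩, hxj⟩
  refine ⟨(Finpartition.ofPairwiseDisjoint (Finset.univ.image K) ?_).copy hsup, fun S hS => ?_⟩
  · intro S hS S' hS' hne
    obtain ⟨p, -, rfl⟩ := Finset.mem_image.1 hS
    obtain ⟨q, -, rfl⟩ := Finset.mem_image.1 hS'
    exact hKdisj p q fun h => hne (by rw [h])
  · obtain ⟨p, -, rfl⟩ := Finset.mem_image.1 (Finset.mem_of_mem_erase hS)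
    exact hK p

/-- A convex subset of `P` is cut out of `P` by two initial parts definable over the same
parameters: its downward closure minus the set of its strict lower bounds. -/
theorem mem_closure_basicSets_of_definablyConvex (hlinear : IsTheoryOfLinearOrders lt T)
    (hSLB : SLB lt T) (hM : InterpretsLT lt M) {A S : Set M} (hS : A.Definable₁ L S)
    (hconv : IsDefinablyConvex L S) : S ∈ BooleanSubalgebra.closure (basicSets L M) := by
  obtain ⟨P, hP, hSP, hconv⟩ := hconv
  have hlt := hM.definablePred_lt A
  have hle : DefinablePred L A fun x : Fin 2 → M => x 0 ≤ x 1 :=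
    (hlt.at₂ (B := fun a b : M => a < b) 1 0).not.congr fun _ => not_lt
  have hS' : DefinablePred L A fun x : Fin 1 → M => x 0 ∈ S := hS
  have h1 : {x | ∃ s, s ∈ S ∧ x ≤ s} ∈ BooleanSubalgebra.closure (basicSets L M) :=
    lowerSet_mem_closure_basicSets hlinear hSLB hM (A := A)
      (fun x y hyx ⟨s, hs, hxs⟩ => ⟨s, hs, hyx.trans hxs⟩)
      (DefinablePred.exists_ ((hS'.at₁ (B := fun a => a ∈ S) 0).and
        (hle.at₂ (B := fun a b : M => a ≤ b) 1 0)))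
  have h2 : {x | ∀ s, s ∈ S → x < s} ∈ BooleanSubalgebra.closure (basicSets L M) :=
    lowerSet_mem_closure_basicSets hlinear hSLB hM (A := A)
      (fun x y hyx hx s hs => hyx.trans_lt (hx s hs))
      (DefinablePred.forall_ ((hS'.at₁ (B := fun a => a ∈ S) 0).imp
        (hlt.at₂ (B := fun a b : M => a < b) 1 0)))
  have h3 : P ∈ BooleanSubalgebra.closure (basicSets L M) :=
    BooleanSubalgebra.subset_closure (Or.inl hP)
  have h4 : S = P ⊓ ({x | ∃ s, s ∈ S ∧ x ≤ s} \ {x | ∀ s, s ∈ S → x < s}) := by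
    ext x
    constructor
    · intro hx
      exact ⟨hSP hx, ⟨x, hx, le_rfl⟩, fun h => lt_irrefl x (h x hx)⟩
    · rintro ⟨hxP, ⟨s, hs, hxs⟩, hn⟩
      simp only [Set.mem_ofPred_eq, not_forall, not_lt] at hn
      obtain ⟨t, ht, htx⟩ := hn
      exact hconv t ht s hs x hxP htx hxs
  rw [h4]
  exact BooleanSubalgebra.inf_mem h3 (BooleanSubalgebra.sdiff_mem h1 h2)

/-- A definable set contains all realizations of `q` or none. Hence each part of the partition is
convex among the realizations and meets at most one component. -/
theorem finite_convexComponentsOn_locus {D : Set M} (Q : Finpartition D)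
    (hQ : ∀ S ∈ Q.parts, IsDefinablyConvex L S) (q : T.CompleteType (Fin 1)) :
    (convexComponentsOn (locus M q) D).Finite := by
  classical
  let f : Set M → Set (Set (locus M q)) := fun S =>
    {K | ∃ x : locus M q, (x : M) ∈ S ∧ K = Set.ordConnectedComponent (Subtype.val ⁻¹' D) x}
  have hf : ∀ S ∈ Q.parts, (f S).Subsingleton := by
    rintro S hS _ ⟨x, hx, rfl⟩ _ ⟨y, hy, rfl⟩
    obtain ⟨P, hP, hSP, hconv⟩ := hQ S hS
    refine Set.ordConnectedComponent_eq fun z hz => ?_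
    have hzP : (z : M) ∈ P := hP.mem_of_locus x.2 z.2 (hSP hx)
    have hSD : S ⊆ D := Q.le hS
    rcases Set.mem_uIcc.1 hz with ⟨h1, h2⟩ | ⟨h1, h2⟩
    · exact hSD (hconv x hx y hy z hzP h1 h2)
    · exact hSD (hconv y hy x hx z hzP h1 h2)
  refine (Q.parts.finite_toSet.biUnion fun S hS => (hf S hS).finite).subset ?_
  rintro K ⟨x, hx, rfl⟩
  have hx' : (x : M) ∈ Q.parts.sup id := by rwa [Q.sup_parts]
  rw [Finset.sup_set_eq_biUnion, Set.mem_iUnion₂] at hx'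
  obtain ⟨S, hS, hxS⟩ := hx'
  exact Set.mem_biUnion hS ⟨x, hxS, rfl⟩

theorem mem_closure_basicSets (hlinear : IsTheoryOfLinearOrders lt T) (hSLB : SLB lt T)
    (hM : InterpretsLT lt M) {A D : Set M} (hD : A.Definable₁ L D) :
    D ∈ BooleanSubalgebra.closure (basicSets L M) := by
  obtain ⟨Q, hQ⟩ := exists_finpartition_definablyConvex hlinear hSLB hM hD
  rw [← Q.sup_parts]
  exact Finset.sup_induction BooleanSubalgebra.bot_mem (fun _ h _ h' => BooleanSubalgebra.sup_mem h h')
    fun S hS => mem_closure_basicSets_of_definablyConvex hlinear hSLB hM (hQ S hS).1 (hQ S hS).2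

end Models

end LinearTheory

theorem mainTheorem11 {L : FirstOrder.Language.{u, v}} (lt : L.Relations 2)
    (T : L.Theory) (hcomplete : T.IsComplete)
    (hlinear : LinearTheory.IsTheoryOfLinearOrders lt T)
    (hinfinite : LinearTheory.HasInfiniteModel T)
    (hSLB : LinearTheory.SLB lt T) :
    (∀ (M : Type w) [L.Structure M] [LinearOrder M] [Nonempty M] [T.Model M],
      LinearTheory.InterpretsLT lt M →
      ∀ (A D : Set M), A.Definable₁ L D →
        D ∈ BooleanSubalgebra.closure
          {S : Set M | LinearTheory.IsUnaryDefinable L S ∨ LinearTheory.IsRay S ∨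
            LinearTheory.IsDefinableConvexClass L S} ∧
        (∀ q : T.CompleteType (Fin 1),
          (LinearTheory.convexComponentsOn (LinearTheory.locus M q) D).Finite) ∧
        ∃ Q : Finpartition D, ∀ S ∈ Q.parts,
          A.Definable₁ L S ∧ LinearTheory.IsDefinablyConvex L S) ∧
    LinearTheory.IsWeaklyQuasiOMinimal.{u, v, w} lt T := by
  refine ⟨fun M _ _ _ _ hM A D hD => ?_, fun M _ _ _ _ hM D hD => ?_⟩
  · obtain ⟨Q, hQ⟩ := LinearTheory.exists_finpartition_definablyConvex hlinear hSLB hM hD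
    exact ⟨LinearTheory.mem_closure_basicSets hlinear hSLB hM hD,
      LinearTheory.finite_convexComponentsOn_locus Q fun S hS => (hQ S hS).2, Q, hQ⟩
  · refine BooleanSubalgebra.closure_mono ?_
      (LinearTheory.mem_closure_basicSets hlinear hSLB hM hD)
    rintro S (hS | ⟨a, rfl | rfl⟩ | ⟨E, hE, a, rfl⟩)
    · exact Or.inl hS
    · exact Or.inr Set.ordConnected_Ioi
    · exact Or.inr Set.ordConnected_Iio
    · exact Or.inr (hE.2 a)
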